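/- The binary erasure MAC has input alphabets $\{0,1\}$, $\{0,1\}$, output alphabet $\{0,1,2\}$ and output $Z=X+Y$ (integer addition); write $W$ for its transition law. Codes. An $(N_1,N_2,n)$ adversary identifying code consists of deterministic encoders $f_i:\{1,\dots,N_i\}\to\{0,1\}^n$ ($i=1,2$) and a deterministic decoder $\phi$ from $\{0,1,2\}^n$ to $(\{1,\dots,N_1\}\times\{1,\dots,N_2\})\cup\{\mathbf b_1,\mathbf b_2\}$, where $\mathbf b_i$ means "user $i$ is adversarial". Its error probability is the maximum of (i) the average over $(m_1,m_2)$ of $W^n(\phi\neq(m_1,m_2)\mid f_1(m_1),f_2(m_2))$; (ii) the maximum over $x\in\{0,1\}^n$ of the average over $m_2$ of the probability under $W^n(\cdot\mid x,f_2(m_2))$ that $\phi$ is neither $\mathbf b_1$ nor a pair with second entry $m_2$; (iii) the maximum over $y\in\{0,1\}^n$ of the average over $m_1$ of the probability under $W^n(\cdot\mid f_1(m_1),y)$ that $\phi$ is neither $\mathbf b_2$ nor a pair with first entry $m_1$. The capacity region $\mathcal C$ of communication with adversary identification is the closure of the set of pairs $(R_1,R_2)$, $R_1,R_2\ge 0$,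 for which there are $(\lfloor 2^{nR_1}\rfloor,\lfloor 2^{nR_2}\rfloor,n)$ adversary identifying codes with error probability tending to $0$ as $n\to\infty$. The non-adversarial capacity region $\mathcal C_{\mathrm{MAC}}$ is defined in the same way with decoders that output a pair of messages and with (i) as the only error criterion. Inner bound. For distributions $P_1,P_2$ on $\{0,1\}$ let $\mathcal P(P_1,P_2)$ be the set of joint distributions of $(X,Y,\tilde X,\tilde Y,Z)$ such that $P_{X\tilde YZ}=P_1\times P_{\tilde Y}\times W$ for some distribution $P_{\tilde Y}$ and $P_{\tilde XYZ}=P_{\tilde X}\times P_2\times W$ for some distribution $P_{\tilde X}$. With information quantities in bits, let $\mathcal R_1(P_1,P_2)$ be the set of pairs $(R_1,R_2)$ with $$0\le R_1\le\min_{\mathcal P(P_1,P_2)}I(X;Z),\qquad 0\le R_2\le\min_{\mathcal P(P_1,P_2):\,X\perp Y}I(Y;Z\mid X),$$ and $\mathcal R_2(P_1,P_2)$ the set of pairs with $$0\le R_1\le\min_{\mathcal P(P_1,P_2):\,X\perp Y}I(X;Z\mid Y),\qquad 0\le R_2\le\min_{\mathcal P(P_1,P_2)}I(Y;Z).$$ Let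 $\mathcal I$ be the closed convex hull of $\bigcup_{P_1,P_2}\bigl(\mathcal R_1(P_1,P_2)\cup\mathcal R_2(P_1,P_2)\bigr)$. Theorem. For the binary erasure MAC, $\mathcal I=\mathcal C_{\mathrm{MAC}}$ and $\mathcal C=\mathcal C_{\mathrm{MAC}}$. Moreover $$\mathcal C_{\mathrm{MAC}}=\{(R_1,R_2):0\le R_1\le 1,\ 0\le R_2\le 1,\ R_1+R_2\le 3/2\},$$ and the extreme points of this region are $(0,0)$, $(1,0)$, $(0,1)$ and the corner points $(1/2,1)$ and $(1,1/2)$. -/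

import Mathlib

open Filter Topology

noncomputable section

namespace ByzMAC

/-! ### Discrete memoryless multiple access channels -/

/-- A two-user multiple access channel with input alphabets `X`, `Y` and output alphabet `Z`;
`law x y z` is the transition probability `W(z | x, y)`. -/
structure MAC (X Y Z : Type) [Fintype Z] where
  law : X → Y → Z → ℝ
  nonneg : ∀ x y z, 0 ≤ law x y z
  sum_one : ∀ x y, ∑ z, law x y z = 1

/-- The binary erasure MAC: binary inputs, output `Z = X + Y` (addition of integers). -/
def erasureMAC : MAC (Fin 2) (Fin 2) (Fin 3) where
  law x y z := if (z : ℕ) = (x : ℕ) + (y : ℕ) then 1 else 0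
  nonneg x y z := by split_ifs <;> norm_num
  sum_one x y := by
    fin_cases x <;> fin_cases y <;> simp <;> decide

variable {X Y Z : Type} [Fintype Z]

/-- `W^n(E | x, y)`: the probability that the output of `n` independent uses of the channel lies
in `E` when the input vectors are `x` and `y`. -/
def MAC.prob (W : MAC X Y Z) {n : ℕ} (x : Fin n → X) (y : Fin n → Y)
    (E : Set (Fin n → Z)) : ℝ :=
  ∑ z : Fin n → Z, E.indicator (fun z => ∏ i, W.law (x i) (y i) (z i)) z

/-- The number `⌊2^{nR}⌋` of messages at rate `R` and blocklength `n`. -/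
def numMsg (R : ℝ) (n : ℕ) : ℕ := ⌊(2 : ℝ) ^ ((n : ℝ) * R)⌋₊

/-! ### Communication with adversary identification -/

/-- Output of a decoder that may, instead of a pair of messages, blame one of the users. -/
inductive Verdict (N₁ N₂ : ℕ) where
  | messages (m₁ : Fin N₁) (m₂ : Fin N₂)
  | blameOne
  | blameTwo

/-- An `(N₁, N₂, n)` deterministic adversary identifying code. -/
structure AdvIdCode (X Y Z : Type) (N₁ N₂ n : ℕ) where
  enc₁ : Fin N₁ → Fin n → X
  enc₂ : Fin N₂ → Fin n → Y
  dec : (Fin n → Z) → Verdict N₁ N₂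

namespace AdvIdCode

variable {N₁ N₂ n : ℕ}

/-- Average probability of error when both users are honest. -/
def errHonest (c : AdvIdCode X Y Z N₁ N₂ n) (W : MAC X Y Z) : ℝ :=
  1 / ((N₁ : ℝ) * N₂) * ∑ m₁ : Fin N₁, ∑ m₂ : Fin N₂,
    W.prob (c.enc₁ m₁) (c.enc₂ m₂) {z | c.dec z ≠ .messages m₁ m₂}

/-- Average probability of error when user 1 is adversarial: user 1 sends the worst vector `x`,
and an error occurs unless user 1 is blamed or the message of user 2 is decoded correctly. -/
def errAdvOne (c : AdvIdCode X Y Z N₁ N₂ n) (W : MAC X Y Z) : ℝ :=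
  ⨆ x : Fin n → X, 1 / (N₂ : ℝ) * ∑ m₂ : Fin N₂,
    W.prob x (c.enc₂ m₂) {z | c.dec z ≠ .blameOne ∧ ∀ m₁, c.dec z ≠ .messages m₁ m₂}

/-- Average probability of error when user 2 is adversarial. -/
def errAdvTwo (c : AdvIdCode X Y Z N₁ N₂ n) (W : MAC X Y Z) : ℝ :=
  ⨆ y : Fin n → Y, 1 / (N₁ : ℝ) * ∑ m₁ : Fin N₁,
    W.prob (c.enc₁ m₁) y {z | c.dec z ≠ .blameTwo ∧ ∀ m₂, c.dec z ≠ .messages m₁ m₂}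

/-- The average probability of error of an adversary identifying code. -/
def err (c : AdvIdCode X Y Z N₁ N₂ n) (W : MAC X Y Z) : ℝ :=
  max (c.errHonest W) (max (c.errAdvOne W) (c.errAdvTwo W))

end AdvIdCode

/-- The capacity region of communication with adversary identification: the closure of the set
of achievable rate pairs. -/
def advIdCapacityRegion (W : MAC X Y Z) : Set (ℝ × ℝ) :=
  closure {R | 0 ≤ R.1 ∧ 0 ≤ R.2 ∧
    ∃ c : (n : ℕ) → AdvIdCode X Y Z (numMsg R.1 n) (numMsg R.2 n) n,
      Tendsto (fun n => (c n).err W) atTop (𝓝 0)}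

/-! ### The non-adversarial capacity region -/

/-- An `(N₁, N₂, n)` code for the (non-adversarial) MAC. -/
structure MACCode (X Y Z : Type) (N₁ N₂ n : ℕ) where
  enc₁ : Fin N₁ → Fin n → X
  enc₂ : Fin N₂ → Fin n → Y
  dec : (Fin n → Z) → Fin N₁ × Fin N₂

/-- Average probability of error of a code for the MAC. -/
def MACCode.err {N₁ N₂ n : ℕ} (c : MACCode X Y Z N₁ N₂ n) (W : MAC X Y Z) : ℝ :=
  1 / ((N₁ : ℝ) * N₂) * ∑ m₁ : Fin N₁, ∑ m₂ : Fin N₂,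
    W.prob (c.enc₁ m₁) (c.enc₂ m₂) {z | c.dec z ≠ (m₁, m₂)}

/-- The (non-adversarial) capacity region of a MAC: the closure of the set of achievable
rate pairs. -/
def macCapacityRegion (W : MAC X Y Z) : Set (ℝ × ℝ) :=
  closure {R | 0 ≤ R.1 ∧ 0 ≤ R.2 ∧
    ∃ c : (n : ℕ) → MACCode X Y Z (numMsg R.1 n) (numMsg R.2 n) n,
      Tendsto (fun n => (c n).err W) atTop (𝓝 0)}

/-! ### Information quantities (in bits) on a finite probability space `(Ω, p)` -/

section Info

variable {Ω A B C : Type} [Fintype Ω]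

/-- The law of the random variable `f` under the probability mass function `p`. -/
def law [DecidableEq A] (p : Ω → ℝ) (f : Ω → A) (a : A) : ℝ :=
  ∑ ω with f ω = a, p ω

/-- Shannon entropy `H(f)`, to base 2. -/
def entropy [Fintype A] [DecidableEq A] (p : Ω → ℝ) (f : Ω → A) : ℝ :=
  (∑ a, Real.negMulLog (law p f a)) / Real.log 2

variable [Fintype A] [Fintype B] [Fintype C] [DecidableEq A] [DecidableEq B] [DecidableEq C]

/-- Mutual information `I(f; g) = H(f) + H(g) - H(f, g)`. -/
def mutualInfo (p : Ω → ℝ) (f : Ω → A) (g : Ω → B) : ℝ :=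
  entropy p f + entropy p g - entropy p (fun ω => (f ω, g ω))

/-- Conditional mutual information
`I(f; g | h) = H(f, h) + H(g, h) - H(f, g, h) - H(h)`. -/
def condMutualInfo (p : Ω → ℝ) (f : Ω → A) (g : Ω → B) (h : Ω → C) : ℝ :=
  entropy p (fun ω => (f ω, h ω)) + entropy p (fun ω => (g ω, h ω))
    - entropy p (fun ω => (f ω, g ω, h ω)) - entropy p h

/-- Independence of the random variables `f` and `g` under `p`. -/
def Indep (p : Ω → ℝ) (f : Ω → A) (g : Ω → B) : Prop :=
  ∀ a b, law p (fun ω => (f ω, g ω)) (a, b) = law p f a * law p g b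

end Info

/-! ### The inner bound -/

section InnerBound

/-- Values of the five random variables `(X, Y, X̃, Ỹ, Z)`. -/
abbrev Quint (X Y Z : Type) : Type := X × Y × X × Y × Z

/-- The coordinate `X`. -/
def cX (ω : Quint X Y Z) : X := ω.1
/-- The coordinate `Y`. -/
def cY (ω : Quint X Y Z) : Y := ω.2.1
/-- The coordinate `X̃`. -/
def cX' (ω : Quint X Y Z) : X := ω.2.2.1
/-- The coordinate `Ỹ`. -/
def cY' (ω : Quint X Y Z) : Y := ω.2.2.2.1
/-- The coordinate `Z`. -/
def cZ (ω : Quint X Y Z) : Z := ω.2.2.2.2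

variable [Fintype X] [Fintype Y] [DecidableEq X] [DecidableEq Y] [DecidableEq Z]

/-- The set `𝒫(P₁, P₂)` of joint distributions of `(X, Y, X̃, Ỹ, Z)` with
`P_{XỸZ} = P₁ × Q₂ × W` for some distribution `Q₂`, and `P_{X̃YZ} = Q₁ × P₂ × W` for some
distribution `Q₁`. -/
def jointLaws (W : MAC X Y Z) (P₁ : X → ℝ) (P₂ : Y → ℝ) : Set (Quint X Y Z → ℝ) :=
  {p | p ∈ stdSimplex ℝ (Quint X Y Z) ∧
    (∃ Q₂ ∈ stdSimplex ℝ Y, ∀ x y z,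
      law p (fun ω => (cX ω, cY' ω, cZ ω)) (x, y, z) = P₁ x * Q₂ y * W.law x y z) ∧
    (∃ Q₁ ∈ stdSimplex ℝ X, ∀ x y z,
      law p (fun ω => (cX' ω, cY ω, cZ ω)) (x, y, z) = Q₁ x * P₂ y * W.law x y z)}

/-- Rate pairs with `R₁ ≤ min I(X; Z)` over `𝒫(P₁, P₂)` and `R₂ ≤ min I(Y; Z | X)` over the
members of `𝒫(P₁, P₂)` with `X` and `Y` independent. A bound by a minimum is written as a bound
by every competitor. -/
def rateRegion₁ (W : MAC X Y Z) (P₁ : X → ℝ) (P₂ : Y → ℝ) : Set (ℝ × ℝ) :=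
  {R | 0 ≤ R.1 ∧ 0 ≤ R.2 ∧
    (∀ p ∈ jointLaws W P₁ P₂, R.1 ≤ mutualInfo p cX cZ) ∧
    (∀ p ∈ jointLaws W P₁ P₂, Indep p cX cY → R.2 ≤ condMutualInfo p cY cZ cX)}

/-- Rate pairs with `R₁ ≤ min I(X; Z | Y)` over the members of `𝒫(P₁, P₂)` with `X` and `Y`
independent, and `R₂ ≤ min I(Y; Z)` over `𝒫(P₁, P₂)`. -/
def rateRegion₂ (W : MAC X Y Z) (P₁ : X → ℝ) (P₂ : Y → ℝ) : Set (ℝ × ℝ) :=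
  {R | 0 ≤ R.1 ∧ 0 ≤ R.2 ∧
    (∀ p ∈ jointLaws W P₁ P₂, Indep p cX cY → R.1 ≤ condMutualInfo p cX cZ cY) ∧
    (∀ p ∈ jointLaws W P₁ P₂, R.2 ≤ mutualInfo p cY cZ)}

/-- The inner bound: the convex closure of the union of the regions `rateRegion₁` and
`rateRegion₂` over all pairs of input distributions. -/
def innerBound (W : MAC X Y Z) : Set (ℝ × ℝ) :=
  closure (convexHull ℝ (⋃ P₁ ∈ stdSimplex ℝ X, ⋃ P₂ ∈ stdSimplex ℝ Y,
    (rateRegion₁ W P₁ P₂ ∪ rateRegion₂ W P₁ P₂)))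

end InnerBound

end ByzMAC

end

namespace ByzMAC

/-! ### The noiseless adder -/

/-! The regions form a chain: pentagon ⊆ `advIdCapacityRegion` ⊆ `macCapacityRegion` ⊆ pentagon. The
middle inclusion forgets the blame; the inner bound is identified with the pentagon separately. As
the channel is deterministic, error probabilities are proportions of messages and the coding
arguments are counting.

Converse (`card_correctPairs_mul_log_le`). Correctly decoded pairs have distinct outputs. Their
number is compared, by Gibbs' inequality, with a product law whose coordinates are sums of two
independent bits of the average bias of the two codebook columns. The cross entropy per coordinate
is at most 3/2 bits (`crossEntropy_sumLaw_le`), which bounds the sum rate; the single rates are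
bounded by injectivity.

Inner bound. The honest law, with `X̃ = X` and `Ỹ = Y`, is a competitor in each minimum, so every
rate region lies in the pentagon. For uniform inputs `I(X;Z) = 1 - h(q)/2 ≥ 1/2`, while independence
of `X` and `Y` forces the law of `(X,Y,Z)` to be the honest one (`law_cX_cY_cZ_of_uniform`), so the
conditional informations equal 1 and the corners are attained.

Achievability. Random codebooks with user 1 below rate 1/2 and user 2 below rate 1 serve one corner.
If user 1 sends `x`, a codeword of user 1 compatible with the output and far from `x` is a
confusion; outside confusions every compatible codeword of user 1 lies within logarithmic distance
`t` of `x`. The decoder accepts a pair of compatible codewords whose sum is within `t` of the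
output. It errs only on confusions or on codewords within `2t` of each other (`okOne_decode`,
`okTwo_decode`). `exists_codebooks` makes these rare for all `x` at once: a decoupling argument
gives failure probability exponentially small in the number of messages, enough for a union bound
over `2 ^ n` words. Exchanging the users gives the other corner, time sharing fills the interior,
and closure gives the boundary. -/

/-- The output word of the binary erasure MAC for the input words `x` and `y`. -/
def addOut {ι : Type*} (x y : ι → Fin 2) (i : ι) : Fin 3 := ⟨(x i : ℕ) + y i, by omega⟩

lemma addOut_comm {ι : Type*} (x y : ι → Fin 2) : addOut x y = addOut y x := by
  funext i
  simp only [addOut, add_comm]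

lemma addOut_apply_left_inj {ι : Type*} {x y u : ι → Fin 2} {i : ι} :
    addOut x y i = addOut u y i ↔ x i = u i := by
  simp only [addOut, Fin.ext_iff]
  omega

lemma addOut_apply_right_inj {ι : Type*} {x y u : ι → Fin 2} {i : ι} :
    addOut x y i = addOut x u i ↔ y i = u i := by
  simp only [addOut, Fin.ext_iff]
  omega

open Classical in
lemma prob_erasureMAC {n : ℕ} (x y : Fin n → Fin 2) (E : Set (Fin n → Fin 3)) :
    erasureMAC.prob x y E = if addOut x y ∈ E then 1 else 0 := by
  have h : ∀ z : Fin n → Fin 3,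
      ∏ i, erasureMAC.law (x i) (y i) (z i) = if z = addOut x y then 1 else 0 := by
    intro z
    simp only [erasureMAC, Fintype.prod_boole, funext_iff, addOut, Fin.ext_iff]
    congr
  simp only [MAC.prob, h, Set.indicator_apply]
  rw [Finset.sum_eq_single (addOut x y)] <;> simp +contextual

/-! ### The pentagon -/

/-- The pentagon `0 ≤ R₁ ≤ 1`, `0 ≤ R₂ ≤ 1`, `R₁ + R₂ ≤ 3 / 2`. -/
def pentagon : Set (ℝ × ℝ) :=
  {R : ℝ × ℝ | 0 ≤ R.1 ∧ R.1 ≤ 1 ∧ 0 ≤ R.2 ∧ R.2 ≤ 1 ∧ R.1 + R.2 ≤ 3 / 2}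

/-- The five corner points of the pentagon. -/
def pentagonVertices : Set (ℝ × ℝ) := {(0, 0), (1, 0), (0, 1), (1 / 2, 1), (1, 1 / 2)}

lemma isClosed_pentagon : IsClosed pentagon := by
  simp only [pentagon, Set.ofPred_and]
  refine IsClosed.inter (isClosed_le ?_ ?_) <| IsClosed.inter (isClosed_le ?_ ?_) <|
    IsClosed.inter (isClosed_le ?_ ?_) <| IsClosed.inter (isClosed_le ?_ ?_)
      (isClosed_le ?_ ?_) <;> fun_prop

lemma convex_pentagon : Convex ℝ pentagon := by
  rintro x ⟨h1, h2, h3, h4, h5⟩ y ⟨k1, k2, k3, k4, k5⟩ a b ha hb hab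
  obtain rfl : b = 1 - a := by linarith
  refine ⟨?_, ?_, ?_, ?_, ?_⟩ <;> simp only [Prod.fst_add, Prod.snd_add, Prod.smul_fst,
    Prod.smul_snd, smul_eq_mul] <;> nlinarith

lemma pentagonVertices_subset : pentagonVertices ⊆ pentagon := by
  rintro _ (rfl | rfl | rfl | rfl | rfl) <;> norm_num [pentagon]

/-- Each point lies on the vertical segment from the bottom edge to the roof, and the roof consists
of the two edges meeting at `(1/2, 1)`. -/
lemma pentagon_subset_of_convex {s : Set (ℝ × ℝ)} (hs : Convex ℝ s)
    (h : pentagonVertices ⊆ s) : pentagon ⊆ s := by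
  have h00 : ((0 : ℝ), (0 : ℝ)) ∈ s := h (by simp [pentagonVertices])
  have h10 : ((1 : ℝ), (0 : ℝ)) ∈ s := h (by simp [pentagonVertices])
  have h01 : ((0 : ℝ), (1 : ℝ)) ∈ s := h (by simp [pentagonVertices])
  have hc1 : ((1 / 2 : ℝ), (1 : ℝ)) ∈ s := h (by simp [pentagonVertices])
  have hc2 : ((1 : ℝ), (1 / 2 : ℝ)) ∈ s := h (by simp [pentagonVertices])
  have hcol : ∀ a T b : ℝ, 0 < T → 0 ≤ b → b ≤ T → (a, (0 : ℝ)) ∈ s → (a, T) ∈ s →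
      (a, b) ∈ s := by
    intro a T b hT hb hbT h0 h1
    have := hs h0 h1 (a := 1 - b / T) (b := b / T)
      (by rw [sub_nonneg, div_le_one hT]; exact hbT) (by positivity) (by ring)
    convert this using 1
    ext <;> simp
    · ring
    · field_simp
  rintro ⟨a, b⟩ ⟨h1, h2, h3, h4, h5⟩
  simp only at h1 h2 h3 h4 h5
  have hbase : (a, (0 : ℝ)) ∈ s := by
    convert hs h00 h10 (a := 1 - a) (b := a) (by linarith) h1 (by ring) using 1
    ext <;> simp
  rcases le_total a (1 / 2) with ha | ha
  · refine hcol a 1 b one_pos h3 h4 hbase ?_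
    convert hs h01 hc1 (a := 1 - 2 * a) (b := 2 * a) (by linarith) (by linarith) (by ring) using 1
    ext <;> simp
    ring
  · refine hcol a (3 / 2 - a) b (by linarith) h3 (by linarith) hbase ?_
    convert hs hc1 hc2 (a := 2 - 2 * a) (b := 2 * a - 1) (by linarith) (by linarith) (by ring)
      using 1
    ext <;> simp <;> ring

lemma convexHull_pentagonVertices : convexHull ℝ pentagonVertices = pentagon :=
  (convexHull_min pentagonVertices_subset convex_pentagon).antisymm
    (pentagon_subset_of_convex (convex_convexHull ℝ _) (subset_convexHull ℝ _))

/-- At each vertex two independent constraints are tight. A convex combination of nonnegative slacks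
vanishes only if both slacks do, so both endpoints are that vertex. -/
lemma extremePoints_pentagon : Set.extremePoints ℝ pentagon = pentagonVertices := by
  refine Set.Subset.antisymm ?_ fun R hR => ⟨pentagonVertices_subset hR, ?_⟩
  · rw [← convexHull_pentagonVertices]
    exact extremePoints_convexHull_subset
  · rintro ⟨x1, x2⟩ ⟨h1, h2, h3, h4, h5⟩ ⟨y1, y2⟩ ⟨k1, k2, k3, k4, k5⟩ ⟨a, b, ha, hb, hab, rfl⟩
    obtain rfl : b = 1 - a := by linarith
    simp only [pentagonVertices, Prod.smul_mk, Prod.mk_add_mk, smul_eq_mul, Set.mem_insert_iff,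
      Prod.mk.injEq, Set.mem_singleton_iff] at hR h1 h2 h3 h4 h5 k1 k2 k3 k4 k5 ⊢
    have eq0 : ∀ u v : ℝ, 0 ≤ u → 0 ≤ v → a * u + (1 - a) * v = 0 → u = 0 ∧ v = 0 := by
      intro u v hu hv h
      have h1 := mul_nonneg ha.le hu
      have h2 := mul_nonneg hb.le hv
      exact ⟨(mul_eq_zero.1 (by linarith : a * u = 0)).resolve_left ha.ne',
        (mul_eq_zero.1 (by linarith : (1 - a) * v = 0)).resolve_left hb.ne'⟩
    have lo1 := eq0 x1 y1 h1 k1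
    have lo2 := eq0 x2 y2 h3 k3
    have up1 := eq0 (1 - x1) (1 - y1) (by linarith) (by linarith)
    have up2 := eq0 (1 - x2) (1 - y2) (by linarith) (by linarith)
    have up3 := eq0 (3 / 2 - (x1 + x2)) (3 / 2 - (y1 + y2)) (by linarith) (by linarith)
    rcases hR with ⟨e1, e2⟩ | ⟨e1, e2⟩ | ⟨e1, e2⟩ | ⟨e1, e2⟩ | ⟨e1, e2⟩
    · have := lo1 e1; have := lo2 e2; constructor <;> linarith
    · have := up1 (by linarith); have := lo2 e2; constructor <;> linarith
    · have := lo1 e1; have := up2 (by linarith); constructor <;> linarith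
    · have := up2 (by linarith); have := up3 (by linarith); constructor <;> linarith
    · have := up1 (by linarith); have := up3 (by linarith); constructor <;> linarith

/-! ### The entropy of a sum of two independent bits -/

/-- Adding `log 2 * (x - 1/2)^2` to the binary entropy keeps it concave, and it is symmetric about
1/2, so its maximum is there. This coefficient is exactly what yields 3/2 below. -/
lemma binEntropy_le_log_two_sub_sq {c : ℝ} (h0 : 0 ≤ c) (h1 : c ≤ 1) :
    Real.binEntropy c ≤ Real.log 2 - Real.log 2 * (c - 1 / 2) ^ 2 := by
  set k := Real.log 2 with hk
  have hk1 : k ≤ 1 := by rw [hk]; linarith [Real.log_two_lt_d9]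
  have hconc : ConcaveOn ℝ (Set.Icc 0 1) fun x => Real.binEntropy x + k * (x - 1 / 2) ^ 2 := by
    refine concaveOn_of_hasDerivWithinAt2_nonpos
      (f' := fun x => Real.log (1 - x) - Real.log x + k * (2 * (x - 1 / 2)))
      (f'' := fun x => -1 / (1 - x) - x⁻¹ + k * 2) (convex_Icc 0 1)
      (by fun_prop) ?_ ?_ ?_ <;> rw [interior_Icc] <;> rintro x ⟨hx0, hx1⟩
    · refine HasDerivAt.hasDerivWithinAt ?_
      refine (Real.hasDerivAt_binEntropy hx0.ne' hx1.ne).add (HasDerivAt.const_mul k ?_)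
      exact (((hasDerivAt_id x).sub_const (1 / 2)).pow 2).congr_deriv (by simp)
    · refine HasDerivAt.hasDerivWithinAt ?_
      refine ((((hasDerivAt_id x).const_sub 1).log (by simp; linarith)).sub
        (Real.hasDerivAt_log hx0.ne')).add (HasDerivAt.const_mul k ?_)
      exact (((hasDerivAt_id x).sub_const (1 / 2)).const_mul 2).congr_deriv (by simp)
    · have hx1' : 0 < 1 - x := by linarith
      have h2 : 1 ≤ 1 / (1 - x) := by rw [le_div_iff₀ hx1']; linarith
      have h3 : 1 ≤ x⁻¹ := (one_le_inv₀ hx0).2 hx1.le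
      have h4 : -1 / (1 - x) = -(1 / (1 - x)) := by ring
      simp only [h4]
      linarith
  have hsymm : 1 - c ∈ Set.Icc (0 : ℝ) 1 := ⟨by linarith, by linarith⟩
  have hhalf : (0 : ℝ) ≤ 1 / 2 := by norm_num
  have key := hconc.2 ⟨h0, h1⟩ hsymm hhalf hhalf (by norm_num)
  have hmid : (1 / 2 : ℝ) * c + 1 / 2 * (1 - c) = 2⁻¹ := by ring
  simp only [smul_eq_mul, Real.binEntropy_one_sub, hmid, Real.binEntropy_two_inv] at key
  nlinarith

/-- The law of the sum of two independent bits which are both `1` with probability `c`. -/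
noncomputable def sumLaw (c : ℝ) : Fin 3 → ℝ := ![(1 - c) ^ 2, 2 * c * (1 - c), c ^ 2]

lemma sumLaw_nonneg {c : ℝ} (h0 : 0 ≤ c) (h1 : c ≤ 1) (z : Fin 3) : 0 ≤ sumLaw c z := by
  have : 0 ≤ 1 - c := by linarith
  fin_cases z <;> simp [sumLaw] <;> positivity

lemma sum_sumLaw (c : ℝ) : ∑ z, sumLaw c z = 1 := by
  simp [sumLaw, Fin.sum_univ_three]; ring

/-- The cross entropy of the sum of two independent bits relative to the sum of two independent
bits of the average bias is at most `3 / 2` bits. -/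
lemma crossEntropy_sumLaw_le {a b : ℝ} (ha0 : 0 ≤ a) (ha1 : a ≤ 1) (hb0 : 0 ≤ b) (hb1 : b ≤ 1) :
    (1 - a) * (1 - b) * -Real.log (sumLaw ((a + b) / 2) 0) +
      (a * (1 - b) + (1 - a) * b) * -Real.log (sumLaw ((a + b) / 2) 1) +
      a * b * -Real.log (sumLaw ((a + b) / 2) 2) ≤ 3 / 2 * Real.log 2 := by
  have hlog : 0 < Real.log 2 := Real.log_pos (by norm_num)
  set c := (a + b) / 2 with hc
  have hc0 : 0 ≤ c := by positivity
  have hc1 : c ≤ 1 := by rw [hc]; linarith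
  simp only [sumLaw, Matrix.cons_val_zero, Matrix.cons_val_one, Matrix.cons_val]
  -- At bias 0 or 1 both bits are constant; these cases are separated because the logarithms do not
  -- split there.
  rcases hc0.eq_or_lt with h | hc0'
  · obtain rfl : a = 0 := by linarith
    obtain rfl : b = 0 := by linarith
    simp [← h]; positivity
  rcases hc1.eq_or_lt with h | hc1'
  · obtain rfl : a = 1 := by linarith
    obtain rfl : b = 1 := by linarith
    simp [h]; positivity
  have hc2 : 0 < 1 - c := by linarith
  rw [Real.log_mul (by positivity) hc2.ne', Real.log_mul two_ne_zero hc0'.ne', Real.log_pow,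
    Real.log_pow]
  have hbin := binEntropy_le_log_two_sub_sq hc0 hc1
  rw [Real.binEntropy, Real.log_inv, Real.log_inv] at hbin
  -- The difference of the two sides is `(a - b)^2 / 2`.
  have hu : 2 * (c * (1 - c)) ≤ a * (1 - b) + (1 - a) * b := by
    rw [hc]; nlinarith [sq_nonneg (a - b)]
  have hbeq : b = 2 * c - a := by rw [hc]; ring
  have hu2 := mul_le_mul_of_nonneg_right hu hlog.le
  push_cast
  -- The weights of `-log c` and `-log (1 - c)` add up to `a + b = 2c` and `2(1 - c)`; the factor 2
  -- in the middle mass gives the subtracted term.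
  calc _ = 2 * (c * -Real.log c + (1 - c) * -Real.log (1 - c)) -
        (a * (1 - b) + (1 - a) * b) * Real.log 2 := by rw [hbeq]; ring
    _ ≤ 2 * (Real.log 2 - Real.log 2 * (c - 1 / 2) ^ 2) - 2 * (c * (1 - c)) * Real.log 2 := by
        linarith
    _ = _ := by ring

/-! ### The converse for the binary erasure MAC -/

section Converse

variable {A B : Type*} [Fintype A] [Fintype B] {n : ℕ}

/-- The message pairs which are decoded correctly. -/
def correctPairs [DecidableEq A] [DecidableEq B] (f₁ : A → Fin n → Fin 2) (f₂ : B → Fin n → Fin 2)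
    (dec : (Fin n → Fin 3) → A × B) : Finset (A × B) :=
  {p | dec (addOut (f₁ p.1) (f₂ p.2)) = p}

/-- The word of user 1 and the message of user 2 determine the output, hence the correctly decoded
pair. -/
lemma card_correctPairs_le_left [DecidableEq A] [DecidableEq B] (f₁ : A → Fin n → Fin 2) (f₂ : B → Fin n → Fin 2)
    (dec : (Fin n → Fin 3) → A × B) :
    (correctPairs f₁ f₂ dec).card ≤ 2 ^ n * Fintype.card B := by
  have : (correctPairs f₁ f₂ dec).card ≤ (Finset.univ : Finset ((Fin n → Fin 2) × B)).card := by
    refine Finset.card_le_card_of_injOn (fun p => (f₁ p.1, p.2)) (by simp) ?_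
    rintro ⟨a, b⟩ hp ⟨a', b'⟩ hp' h
    simp only [correctPairs, Finset.coe_filter, Finset.mem_univ, true_and, Set.mem_ofPred_eq,
      Prod.mk.injEq] at hp hp' h
    rw [← hp, ← hp', h.1, h.2]
  simpa using this

lemma card_correctPairs_le_right [DecidableEq A] [DecidableEq B] (f₁ : A → Fin n → Fin 2) (f₂ : B → Fin n → Fin 2)
    (dec : (Fin n → Fin 3) → A × B) :
    (correctPairs f₁ f₂ dec).card ≤ 2 ^ n * Fintype.card A := by
  have : (correctPairs f₁ f₂ dec).card ≤ (Finset.univ : Finset ((Fin n → Fin 2) × A)).card := by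
    refine Finset.card_le_card_of_injOn (fun p => (f₂ p.2, p.1)) (by simp) ?_
    rintro ⟨a, b⟩ hp ⟨a', b'⟩ hp' h
    simp only [correctPairs, Finset.coe_filter, Finset.mem_univ, true_and, Set.mem_ofPred_eq,
      Prod.mk.injEq] at hp hp' h
    rw [← hp, ← hp', h.1, h.2]
  simpa using this

/-- The fraction of ones of a binary function on a finite type. -/
noncomputable def onesFrac (u : A → Fin 2) : ℝ := (∑ a, ((u a : ℕ) : ℝ)) / Fintype.card A

lemma onesFrac_nonneg (u : A → Fin 2) : 0 ≤ onesFrac u := by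
  unfold onesFrac; positivity

lemma onesFrac_le_one (u : A → Fin 2) : onesFrac u ≤ 1 := by
  refine div_le_one_of_le₀ ?_ (by positivity)
  calc ∑ a, ((u a : ℕ) : ℝ) ≤ ∑ _a : A, (1 : ℝ) :=
        Finset.sum_le_sum fun a _ => by exact_mod_cast Nat.le_of_lt_succ (u a).2
    _ = Fintype.card A := by simp

lemma sum_comp_eq_onesFrac [Nonempty A] (u : A → Fin 2) (h : Fin 2 → ℝ) :
    ∑ a, h (u a) = Fintype.card A * ((1 - onesFrac u) * h 0 + onesFrac u * h 1) := by
  have hcard : (Fintype.card A : ℝ) ≠ 0 := by positivity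
  have : ∀ x : Fin 2, h x = h 0 + ((x : ℕ) : ℝ) * (h 1 - h 0) := by
    intro x; fin_cases x <;> simp
  rw [Finset.sum_congr rfl fun a _ => this (u a), Finset.sum_add_distrib, ← Finset.sum_mul]
  simp only [Finset.sum_const, Finset.card_univ, nsmul_eq_mul, onesFrac]
  field_simp
  ring

lemma onesFrac_pos {u : A → Fin 2} {a : A} (h : u a = 1) : 0 < onesFrac u := by
  have : Nonempty A := ⟨a⟩
  refine div_pos (lt_of_lt_of_le one_pos ?_) (by positivity)
  calc (1 : ℝ) = ((u a : ℕ) : ℝ) := by rw [h]; simp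
    _ ≤ _ := Finset.single_le_sum (f := fun a => ((u a : ℕ) : ℝ))
        (fun _ _ => by positivity) (Finset.mem_univ a)

lemma onesFrac_lt_one {u : A → Fin 2} {a : A} (h : u a = 0) : onesFrac u < 1 := by
  have : Nonempty A := ⟨a⟩
  rw [onesFrac, div_lt_one (by positivity)]
  calc ∑ a, ((u a : ℕ) : ℝ) < ∑ _a : A, (1 : ℝ) :=
        Finset.sum_lt_sum (fun a _ => by exact_mod_cast Nat.le_of_lt_succ (u a).2)
          ⟨a, Finset.mem_univ a, by simp [h]⟩
    _ = Fintype.card A := by simp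

/-- Outputs that occur have positive mass under the comparison law, so their logarithms are not the
default value at 0. -/
lemma sumLaw_onesFrac_pos (u : A → Fin 2) (v : B → Fin 2) (a : A) (b : B) :
    0 < sumLaw ((onesFrac u + onesFrac v) / 2) ⟨(u a : ℕ) + v b, by omega⟩ := by
  have h0 := onesFrac_nonneg u
  have h1 := onesFrac_le_one u
  have k0 := onesFrac_nonneg v
  have k1 := onesFrac_le_one v
  set c := (onesFrac u + onesFrac v) / 2 with hc
  clear_value c
  have hone : u a = 1 ∨ v b = 1 → 0 < c := by
    rintro (h | h) <;> [have := onesFrac_pos h; have := onesFrac_pos h] <;> rw [hc] <;> linarith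
  have hzero : u a = 0 ∨ v b = 0 → 0 < 1 - c := by
    rintro (h | h) <;> [have := onesFrac_lt_one h; have := onesFrac_lt_one h] <;> rw [hc] <;>
      linarith
  have h2 : ∀ x : Fin 2, x = 0 ∨ x = 1 := by decide
  rcases h2 (u a) with h | h <;> rcases h2 (v b) with h' | h' <;>
    simp only [h, h', true_or, or_true, true_imp_iff] at hone hzero ⊢ <;>
    simp [sumLaw] <;> positivity

/-- For uniform independent messages, one column of the two codebooks is a pair of independent bits
whose biases are the fractions of ones. -/
lemma sum_neg_log_sumLaw_le [Nonempty A] [Nonempty B] (u : A → Fin 2) (v : B → Fin 2) :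
    ∑ a, ∑ b, -Real.log (sumLaw ((onesFrac u + onesFrac v) / 2) ⟨(u a : ℕ) + v b, by omega⟩) ≤
      Fintype.card A * Fintype.card B * (3 / 2 * Real.log 2) := by
  set g : Fin 2 → Fin 2 → ℝ := fun x y =>
    -Real.log (sumLaw ((onesFrac u + onesFrac v) / 2) ⟨(x : ℕ) + y, by omega⟩) with hg
  have h1 : ∀ a, ∑ b, g (u a) (v b) =
      Fintype.card B * ((1 - onesFrac v) * g (u a) 0 + onesFrac v * g (u a) 1) := fun a =>
    sum_comp_eq_onesFrac v (g (u a))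
  have h2 := sum_comp_eq_onesFrac u fun x =>
    Fintype.card B * ((1 - onesFrac v) * g x 0 + onesFrac v * g x 1)
  have h3 := crossEntropy_sumLaw_le (onesFrac_nonneg u) (onesFrac_le_one u) (onesFrac_nonneg v)
    (onesFrac_le_one v)
  calc _ = ∑ a, ∑ b, g (u a) (v b) := rfl
    _ = Fintype.card A * Fintype.card B *
        ((1 - onesFrac u) * (1 - onesFrac v) * g 0 0 + (onesFrac u * (1 - onesFrac v) +
          (1 - onesFrac u) * onesFrac v) * g 0 1 + onesFrac u * onesFrac v * g 1 1) := by
        rw [Finset.sum_congr rfl fun a _ => h1 a, h2]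
        have : g 1 0 = g 0 1 := rfl
        rw [this]
        ring
    _ ≤ _ := mul_le_mul_of_nonneg_left h3 (by positivity)

/-- The comparison law `Q` has total mass 1 and the outputs of correct pairs are distinct, so Gibbs'
inequality bounds `|C| log |C|` by the sum of `-log Q` over `C`. Extending the sum to all pairs lets
it be evaluated coordinate by coordinate, without Fano's inequality. -/
lemma card_correctPairs_mul_log_le [DecidableEq A] [DecidableEq B] [Nonempty A] [Nonempty B]
    (f₁ : A → Fin n → Fin 2) (f₂ : B → Fin n → Fin 2) (dec : (Fin n → Fin 3) → A × B) :
    (correctPairs f₁ f₂ dec).card * Real.log (correctPairs f₁ f₂ dec).card ≤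
      Fintype.card A * Fintype.card B * (n * (3 / 2 * Real.log 2)) := by
  set C := correctPairs f₁ f₂ dec with hC
  let c : Fin n → ℝ := fun i => (onesFrac (f₁ · i) + onesFrac (f₂ · i)) / 2
  have hc0 : ∀ i, 0 ≤ c i := fun i => by
    have := onesFrac_nonneg (f₁ · i); have := onesFrac_nonneg (f₂ · i)
    simp only [c]; linarith
  have hc1 : ∀ i, c i ≤ 1 := fun i => by
    have := onesFrac_le_one (f₁ · i); have := onesFrac_le_one (f₂ · i)
    simp only [c]; linarith
  let Q : (Fin n → Fin 3) → ℝ := fun z => ∏ i, sumLaw (c i) (z i)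
  have hQsum : ∑ z, Q z = 1 := by
    simp only [Q]
    rw [← Fintype.piFinset_univ, ← Finset.prod_univ_sum]
    simp [sum_sumLaw]
  have hQ0 : ∀ z, 0 ≤ Q z := fun z =>
    Finset.prod_nonneg fun i _ => sumLaw_nonneg (hc0 i) (hc1 i) _
  have hQ1 : ∀ z, Q z ≤ 1 := fun z => by
    rw [← hQsum]; exact Finset.single_le_sum (fun z _ => hQ0 z) (Finset.mem_univ z)
  let out : A × B → Fin n → Fin 3 := fun p => addOut (f₁ p.1) (f₂ p.2)
  have hpos : ∀ p i, 0 < sumLaw (c i) (out p i) := fun p i =>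
    sumLaw_onesFrac_pos (f₁ · i) (f₂ · i) p.1 p.2
  have hQpos : ∀ p, 0 < Q (out p) := fun p => Finset.prod_pos fun i _ => hpos p i
  have hinj : Set.InjOn out C := by
    intro p hp p' hp' h
    simp only [hC, correctPairs, Finset.coe_filter, Finset.mem_univ, true_and,
      Set.mem_ofPred_eq] at hp hp'
    rw [← hp, ← hp']
    exact congrArg dec h
  have hsumC : ∑ p ∈ C, Q (out p) ≤ 1 := by
    rw [← hQsum, ← Finset.sum_image (f := Q) hinj]
    exact Finset.sum_le_univ_sum_of_nonneg hQ0
  have htotal : ∑ p, -Real.log (Q (out p)) ≤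
      Fintype.card A * Fintype.card B * (n * (3 / 2 * Real.log 2)) := by
    calc ∑ p, -Real.log (Q (out p)) = ∑ p, ∑ i, -Real.log (sumLaw (c i) (out p i)) := by
          refine Finset.sum_congr rfl fun p _ => ?_
          rw [Real.log_prod fun i _ => (hpos p i).ne', Finset.sum_neg_distrib]
      _ = ∑ i, ∑ a, ∑ b, -Real.log (sumLaw (c i) (out (a, b) i)) := by
          rw [Finset.sum_comm]
          simp only [Fintype.sum_prod_type]
      _ ≤ ∑ _i : Fin n, Fintype.card A * Fintype.card B * (3 / 2 * Real.log 2) :=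
          Finset.sum_le_sum fun i _ => sum_neg_log_sumLaw_le (f₁ · i) (f₂ · i)
      _ = _ := by simp; ring
  have hCle : ∑ p ∈ C, -Real.log (Q (out p)) ≤ ∑ p, -Real.log (Q (out p)) :=
    Finset.sum_le_univ_sum_of_nonneg fun p =>
      neg_nonneg.2 (Real.log_nonpos (hQ0 _) (hQ1 _))
  rcases C.eq_empty_or_nonempty with h | h
  · simp only [h, Finset.card_empty, Nat.cast_zero, zero_mul]; positivity
  have hcard : (0 : ℝ) < C.card := by exact_mod_cast h.card_pos
  -- Gibbs' inequality for the uniform law on `C` through `log s ≤ s - 1`; the right side sums to at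
  -- most 0.
  have hgibbs : ∑ p ∈ C, (Real.log C.card + Real.log (Q (out p))) ≤
      ∑ p ∈ C, (C.card * Q (out p) - 1) := by
    refine Finset.sum_le_sum fun p _ => ?_
    rw [← Real.log_mul hcard.ne' (hQpos p).ne']
    exact Real.log_le_sub_one_of_pos (mul_pos hcard (hQpos p))
  rw [Finset.sum_add_distrib, Finset.sum_sub_distrib, ← Finset.mul_sum] at hgibbs
  simp only [Finset.sum_const, nsmul_eq_mul, mul_one] at hgibbs
  rw [Finset.sum_neg_distrib] at hCle
  have := mul_le_mul_of_nonneg_left hsumC hcard.le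
  linarith

end Converse

/-! ### From counting correct pairs to bounds on rates. -/

lemma MACCode.err_erasureMAC {N₁ N₂ n : ℕ} (h₁ : 0 < N₁) (h₂ : 0 < N₂)
    (c : MACCode (Fin 2) (Fin 2) (Fin 3) N₁ N₂ n) :
    (1 - c.err erasureMAC) * (N₁ * N₂) = (correctPairs c.enc₁ c.enc₂ c.dec).card := by
  have h₁' : (N₁ : ℝ) ≠ 0 := by positivity
  have h₂' : (N₂ : ℝ) ≠ 0 := by positivity
  have hsum : ∑ p : Fin N₁ × Fin N₂, (if c.dec (addOut (c.enc₁ p.1) (c.enc₂ p.2)) ≠ p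
      then (1 : ℝ) else 0) + (correctPairs c.enc₁ c.enc₂ c.dec).card = N₁ * N₂ := by
    rw [correctPairs, Finset.card_filter, Nat.cast_sum, ← Finset.sum_add_distrib]
    trans ∑ p : Fin N₁ × Fin N₂, (1 : ℝ)
    · refine Finset.sum_congr rfl fun p _ => ?_
      by_cases h : c.dec (addOut (c.enc₁ p.1) (c.enc₂ p.2)) = p <;> simp [h]
    · simp
  have herr : c.err erasureMAC = 1 / ((N₁ : ℝ) * N₂) * ∑ p : Fin N₁ × Fin N₂,
      (if c.dec (addOut (c.enc₁ p.1) (c.enc₂ p.2)) ≠ p then (1 : ℝ) else 0) := by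
    simp only [MACCode.err, prob_erasureMAC, Set.mem_ofPred_eq, Fintype.sum_prod_type]
    congr! 5
  rw [herr, eq_sub_of_add_eq hsum]
  field_simp
  ring

lemma MACCode.err_nonneg {X Y Z : Type} [Fintype Z] {N₁ N₂ n : ℕ} (c : MACCode X Y Z N₁ N₂ n)
    (W : MAC X Y Z) : 0 ≤ c.err W := by
  refine mul_nonneg (by positivity) <| Finset.sum_nonneg fun _ _ => Finset.sum_nonneg fun _ _ =>
    Finset.sum_nonneg fun _ _ => Set.indicator_nonneg (fun _ _ => ?_) _
  exact Finset.prod_nonneg fun _ _ => W.nonneg _ _ _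

lemma one_le_two_rpow {R : ℝ} (hR : 0 ≤ R) (n : ℕ) : 1 ≤ (2 : ℝ) ^ ((n : ℝ) * R) :=
  Real.one_le_rpow (by norm_num) (by positivity)

lemma numMsg_pos {R : ℝ} (hR : 0 ≤ R) (n : ℕ) : 0 < numMsg R n :=
  Nat.floor_pos.2 (one_le_two_rpow hR n)

lemma numMsg_le (R : ℝ) (n : ℕ) : (numMsg R n : ℝ) ≤ 2 ^ ((n : ℝ) * R) :=
  Nat.floor_le (by positivity)

lemma two_rpow_le_two_mul_numMsg {R : ℝ} (hR : 0 ≤ R) (n : ℕ) :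
    (2 : ℝ) ^ ((n : ℝ) * R) ≤ 2 * numMsg R n := by
  have h1 : (1 : ℝ) ≤ numMsg R n := by exact_mod_cast numMsg_pos hR n
  have h2 := Nat.lt_floor_add_one ((2 : ℝ) ^ ((n : ℝ) * R))
  rw [← numMsg] at h2
  linarith

lemma log_numMsg_ge {R : ℝ} (hR : 0 ≤ R) (n : ℕ) :
    n * (R * Real.log 2) - Real.log 2 ≤ Real.log (numMsg R n) := by
  have hpos : (0 : ℝ) < numMsg R n := by exact_mod_cast numMsg_pos hR n
  have h := Real.log_le_log (by positivity) (two_rpow_le_two_mul_numMsg hR n)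
  rw [Real.log_rpow two_pos, Real.log_mul two_ne_zero hpos.ne'] at h
  linarith

/-- Divide by `n` and pass to the limit. The slack `2 * log 2` covers the floors in two message
counts. -/
lemma rate_le_of_tendsto {R B : ℝ} {ρ : ℕ → ℝ} (hρ : Tendsto ρ atTop (𝓝 1))
    (h : ∀ᶠ n : ℕ in atTop,
      ρ n * (Real.log (ρ n) + n * (R * Real.log 2) - 2 * Real.log 2) ≤ n * (B * Real.log 2)) :
    R ≤ B := by
  have hlog : 0 < Real.log 2 := Real.log_pos (by norm_num)
  have h1 : Tendsto (fun n : ℕ => (Real.log (ρ n) - 2 * Real.log 2) / n) atTop (𝓝 0) :=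
    (((hρ.log one_ne_zero).sub_const _)).div_atTop tendsto_natCast_atTop_atTop
  have h2 : Tendsto (fun n : ℕ => ρ n * ((Real.log (ρ n) - 2 * Real.log 2) / n + R * Real.log 2))
      atTop (𝓝 (1 * (0 + R * Real.log 2))) := hρ.mul (h1.add_const _)
  have h3 : 1 * (0 + R * Real.log 2) ≤ B * Real.log 2 := by
    refine le_of_tendsto h2 ?_
    filter_upwards [h, eventually_gt_atTop 0] with n hn hn0
    have hn0' : (0 : ℝ) < n := by exact_mod_cast hn0
    refine le_of_mul_le_mul_left (le_trans (le_of_eq ?_) hn) hn0'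
    field_simp
    ring
  rw [one_mul, zero_add] at h3
  exact le_of_mul_le_mul_right h3 hlog

theorem macCapacityRegion_erasureMAC_subset :
    macCapacityRegion erasureMAC ⊆ pentagon := by
  refine closure_minimal ?_ isClosed_pentagon
  rintro ⟨R₁, R₂⟩ ⟨h1, h2, c, hc⟩
  simp only at h1 h2 c hc
  have hlog : 0 < Real.log 2 := Real.log_pos (by norm_num)
  set ρ : ℕ → ℝ := fun n => 1 - (c n).err erasureMAC with hρdef
  have hρ : Tendsto ρ atTop (𝓝 1) := by simpa using hc.const_sub 1
  have hev : ∀ᶠ n in atTop, 0 < ρ n := hρ.eventually_const_lt one_pos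
  have hρ1 : ∀ n, ρ n ≤ 1 := fun n => by
    have := (c n).err_nonneg erasureMAC
    simp only [hρdef]; linarith
  have hcard : ∀ n, ρ n * (numMsg R₁ n * numMsg R₂ n) =
      (correctPairs (c n).enc₁ (c n).enc₂ (c n).dec).card := fun n =>
    (c n).err_erasureMAC (numMsg_pos h1 n) (numMsg_pos h2 n)
  have hp1 : ∀ n, (0 : ℝ) < numMsg R₁ n := fun n => by exact_mod_cast numMsg_pos h1 n
  have hp2 : ∀ n, (0 : ℝ) < numMsg R₂ n := fun n => by exact_mod_cast numMsg_pos h2 n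
  have single : ∀ R : ℝ, 0 ≤ R → (∀ n, ρ n * numMsg R n ≤ 2 ^ n) → R ≤ 1 := by
    intro R hR hle
    refine rate_le_of_tendsto hρ ?_
    filter_upwards [hev] with n hn
    have hpos : (0 : ℝ) < numMsg R n := by exact_mod_cast numMsg_pos hR n
    have h3 := Real.log_le_log (mul_pos hn hpos) (hle n)
    rw [Real.log_mul hn.ne' hpos.ne', Real.log_pow] at h3
    have h4 := log_numMsg_ge hR n
    have h5 : Real.log (ρ n) + n * (R * Real.log 2) - 2 * Real.log 2 ≤ n * Real.log 2 := by
      linarith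
    calc _ ≤ ρ n * (n * Real.log 2) := mul_le_mul_of_nonneg_left h5 hn.le
      _ ≤ 1 * (n * Real.log 2) := mul_le_mul_of_nonneg_right (hρ1 n) (by positivity)
      _ = _ := by ring
  refine ⟨h1, single R₁ h1 fun n => ?_, h2, single R₂ h2 fun n => ?_, ?_⟩
  · refine le_of_mul_le_mul_right ?_ (hp2 n)
    rw [mul_assoc, hcard]
    have := card_correctPairs_le_left (c n).enc₁ (c n).enc₂ (c n).dec
    rw [Fintype.card_fin] at this
    exact_mod_cast this
  · refine le_of_mul_le_mul_right ?_ (hp1 n)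
    rw [mul_assoc, mul_comm (numMsg R₂ n : ℝ), hcard]
    have := card_correctPairs_le_right (c n).enc₁ (c n).enc₂ (c n).dec
    rw [Fintype.card_fin] at this
    exact_mod_cast this
  · refine rate_le_of_tendsto hρ ?_
    filter_upwards [hev] with n hn
    have : Nonempty (Fin (numMsg R₁ n)) := ⟨⟨0, numMsg_pos h1 n⟩⟩
    have : Nonempty (Fin (numMsg R₂ n)) := ⟨⟨0, numMsg_pos h2 n⟩⟩
    have h3 := card_correctPairs_mul_log_le (c n).enc₁ (c n).enc₂ (c n).dec
    rw [← hcard, Fintype.card_fin, Fintype.card_fin, Real.log_mul hn.ne'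
      (mul_pos (hp1 n) (hp2 n)).ne', Real.log_mul (hp1 n).ne' (hp2 n).ne'] at h3
    have h4 : ρ n * (Real.log (ρ n) + (Real.log (numMsg R₁ n) + Real.log (numMsg R₂ n))) ≤
        n * (3 / 2 * Real.log 2) := by
      refine le_of_mul_le_mul_left ?_ (mul_pos (hp1 n) (hp2 n))
      linarith
    refine le_trans (mul_le_mul_of_nonneg_left ?_ hn.le) h4
    linarith [log_numMsg_ge h1 n, log_numMsg_ge h2 n]

/-! ### The inner bound for the binary erasure MAC -/

section Law

variable {Ω A B : Type} [Fintype Ω] [Fintype A] [DecidableEq A] [DecidableEq B]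

lemma law_comp (p : Ω → ℝ) (f : Ω → A) (g : A → B) (b : B) :
    law p (fun ω => g (f ω)) b = ∑ a, if g a = b then law p f a else 0 := by
  simp only [law, ← Finset.sum_filter]
  rw [Finset.sum_comm' (t' := Finset.univ.filter fun ω => g (f ω) = b)
    (s' := fun ω => {f ω})]
  · simp
  · intro a ω
    simp only [Finset.mem_filter, Finset.mem_univ, true_and, Finset.mem_singleton]
    constructor
    · rintro ⟨h, rfl⟩; exact ⟨rfl, h⟩
    · rintro ⟨rfl, h⟩; exact ⟨h, rfl⟩

lemma law_nonneg {p : Ω → ℝ} (hp : ∀ ω, 0 ≤ p ω) (f : Ω → B) (b : B) : 0 ≤ law p f b :=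
  Finset.sum_nonneg fun ω _ => hp ω

end Law

/-- The values of `(X, Y, X̃, Ỹ, Z)` for `X̃ = X = x`, `Ỹ = Y = y` and `Z = X + Y`. -/
def honestPoint (w : Fin 2 × Fin 2) : Quint (Fin 2) (Fin 2) (Fin 3) :=
  (w.1, w.2, w.1, w.2, ⟨(w.1 : ℕ) + w.2, by omega⟩)

/-- The joint law of `(X, Y, X, Y, X + Y)` for independent `X ∼ P₁` and `Y ∼ P₂`. -/
def honestLaw (P₁ P₂ : Fin 2 → ℝ) (ω : Quint (Fin 2) (Fin 2) (Fin 3)) : ℝ :=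
  ∑ w : Fin 2 × Fin 2, if honestPoint w = ω then P₁ w.1 * P₂ w.2 else 0

section HonestLaw

variable (P₁ P₂ : Fin 2 → ℝ) {A : Type} [DecidableEq A]

lemma law_honestLaw (f : Quint (Fin 2) (Fin 2) (Fin 3) → A) (a : A) :
    law (honestLaw P₁ P₂) f a =
      ∑ w : Fin 2 × Fin 2, if f (honestPoint w) = a then P₁ w.1 * P₂ w.2 else 0 := by
  simp only [law, honestLaw]
  rw [Finset.sum_comm]
  simp only [Finset.sum_ite_eq, Finset.mem_filter, Finset.mem_univ, true_and]

variable {P₁ P₂}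

/-- Under the honest law all randomness is in the independent pair `(X, Y)`; a variable that
determines this pair has its entropy `H(X) + H(Y)`. -/
lemma entropy_honestLaw_of_injective [Fintype A] (h₁ : P₁ 0 + P₁ 1 = 1) (h₂ : P₂ 0 + P₂ 1 = 1)
    {f : Quint (Fin 2) (Fin 2) (Fin 3) → A}
    (hf : Function.Injective fun w => f (honestPoint w)) :
    entropy (honestLaw P₁ P₂) f = (Real.negMulLog (P₁ 0) + Real.negMulLog (P₁ 1) +
      (Real.negMulLog (P₂ 0) + Real.negMulLog (P₂ 1))) / Real.log 2 := by
  have h : ∑ a, Real.negMulLog (law (honestLaw P₁ P₂) f a) =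
      ∑ w : Fin 2 × Fin 2, Real.negMulLog (P₁ w.1 * P₂ w.2) := by
    symm
    refine Finset.sum_of_injOn (fun w => f (honestPoint w)) hf.injOn (by simp) ?_ ?_
    · intro a _ ha
      rw [law_honestLaw, Finset.sum_eq_zero, Real.negMulLog_zero]
      intro w _
      rw [if_neg]
      rintro rfl
      exact ha ⟨w, by simp, rfl⟩
    · intro w _
      rw [law_honestLaw, Finset.sum_eq_single w]
      · simp
      · intro w' _ hw
        exact if_neg fun h => hw (hf h)
      · simp
  rw [entropy, h]
  congr 1
  simp only [Fintype.sum_prod_type, Fin.sum_univ_two, Real.negMulLog_mul]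
  linear_combination (Real.negMulLog (P₁ 0) + Real.negMulLog (P₁ 1)) * h₂ +
    (Real.negMulLog (P₂ 0) + Real.negMulLog (P₂ 1)) * h₁

/-- The auxiliary laws are the input laws themselves, since `X̃ = X` and `Ỹ = Y`. -/
lemma honestLaw_mem_jointLaws (h₁ : P₁ ∈ stdSimplex ℝ (Fin 2)) (h₂ : P₂ ∈ stdSimplex ℝ (Fin 2)) :
    honestLaw P₁ P₂ ∈ jointLaws erasureMAC P₁ P₂ := by
  refine ⟨⟨fun ω => ?_, ?_⟩, ⟨P₂, h₂, ?_⟩, P₁, h₁, ?_⟩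
  · refine Finset.sum_nonneg fun w _ => ?_
    split_ifs
    exacts [mul_nonneg (h₁.1 _) (h₂.1 _), le_rfl]
  · simp only [honestLaw]
    rw [Finset.sum_comm]
    simp only [Finset.sum_ite_eq, Finset.mem_univ, if_true, Fintype.sum_prod_type,
      ← Finset.mul_sum, h₂.2, mul_one, h₁.2]
  all_goals
    intro x y z
    rw [law_honestLaw]
    fin_cases x <;> fin_cases y <;> fin_cases z <;>
      simp [Fintype.sum_prod_type, honestPoint, cX, cY, cX', cY', cZ, erasureMAC]

lemma law_honestLaw_cX (h₂ : P₂ 0 + P₂ 1 = 1) (x : Fin 2) :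
    law (honestLaw P₁ P₂) cX x = P₁ x := by
  rw [law_honestLaw]
  fin_cases x <;> simp [Fintype.sum_prod_type, honestPoint, cX, ← mul_add, h₂]

lemma law_honestLaw_cY (h₁ : P₁ 0 + P₁ 1 = 1) (y : Fin 2) :
    law (honestLaw P₁ P₂) cY y = P₂ y := by
  rw [law_honestLaw]
  fin_cases y <;> simp [Fintype.sum_prod_type, honestPoint, cY, ← add_mul, h₁]

lemma indep_honestLaw (h₁ : P₁ 0 + P₁ 1 = 1) (h₂ : P₂ 0 + P₂ 1 = 1) :
    Indep (honestLaw P₁ P₂) cX cY := by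
  intro x y
  rw [law_honestLaw_cX h₂, law_honestLaw_cY h₁, law_honestLaw]
  fin_cases x <;> fin_cases y <;> simp [honestPoint, cX, cY]

lemma mutualInfo_honestLaw_cX_cZ (h₁ : P₁ 0 + P₁ 1 = 1) (h₂ : P₂ 0 + P₂ 1 = 1) :
    mutualInfo (honestLaw P₁ P₂) cX cZ = entropy (honestLaw P₁ P₂) cZ -
      (Real.negMulLog (P₂ 0) + Real.negMulLog (P₂ 1)) / Real.log 2 := by
  rw [mutualInfo, entropy_honestLaw_of_injective (f := fun ω => (cX ω, cZ ω)) h₁ h₂ (by decide),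
    entropy]
  simp only [law_honestLaw_cX h₂, Fin.sum_univ_two]
  ring

lemma mutualInfo_honestLaw_cY_cZ (h₁ : P₁ 0 + P₁ 1 = 1) (h₂ : P₂ 0 + P₂ 1 = 1) :
    mutualInfo (honestLaw P₁ P₂) cY cZ = entropy (honestLaw P₁ P₂) cZ -
      (Real.negMulLog (P₁ 0) + Real.negMulLog (P₁ 1)) / Real.log 2 := by
  rw [mutualInfo, entropy_honestLaw_of_injective (f := fun ω => (cY ω, cZ ω)) h₁ h₂ (by decide),
    entropy]
  simp only [law_honestLaw_cY h₁, Fin.sum_univ_two]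
  ring

lemma condMutualInfo_honestLaw_cY_cZ_cX (h₁ : P₁ 0 + P₁ 1 = 1) (h₂ : P₂ 0 + P₂ 1 = 1) :
    condMutualInfo (honestLaw P₁ P₂) cY cZ cX =
      (Real.negMulLog (P₂ 0) + Real.negMulLog (P₂ 1)) / Real.log 2 := by
  rw [condMutualInfo, entropy_honestLaw_of_injective h₁ h₂ (by decide),
    entropy_honestLaw_of_injective h₁ h₂ (by decide),
    entropy_honestLaw_of_injective h₁ h₂ (by decide), entropy]
  simp only [law_honestLaw_cX h₂, Fin.sum_univ_two]
  ring

lemma condMutualInfo_honestLaw_cX_cZ_cY (h₁ : P₁ 0 + P₁ 1 = 1) (h₂ : P₂ 0 + P₂ 1 = 1) :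
    condMutualInfo (honestLaw P₁ P₂) cX cZ cY =
      (Real.negMulLog (P₁ 0) + Real.negMulLog (P₁ 1)) / Real.log 2 := by
  rw [condMutualInfo, entropy_honestLaw_of_injective h₁ h₂ (by decide),
    entropy_honestLaw_of_injective h₁ h₂ (by decide),
    entropy_honestLaw_of_injective h₁ h₂ (by decide), entropy]
  simp only [law_honestLaw_cY h₁, Fin.sum_univ_two]
  ring

lemma sum_negMulLog_law_honestLaw_cZ : ∑ z, Real.negMulLog (law (honestLaw P₁ P₂) cZ z) =
    Real.negMulLog (P₁ 0 * P₂ 0) + Real.negMulLog (P₁ 1 * P₂ 0 + P₁ 0 * P₂ 1) +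
      Real.negMulLog (P₁ 1 * P₂ 1) := by
  simp [Fin.sum_univ_three, law_honestLaw, Fintype.sum_prod_type, honestPoint, cZ, Fin.ext_iff,
    add_comm]

end HonestLaw

/-! ### Entropy inequalities placing the rate regions in the pentagon. -/

lemma negMulLog_add_le {s t : ℝ} (hs : 0 ≤ s) (ht : 0 ≤ t) :
    Real.negMulLog (s + t) ≤ Real.negMulLog s + Real.negMulLog t := by
  rcases hs.eq_or_lt with rfl | hs'
  · simp
  rcases ht.eq_or_lt with rfl | ht'
  · simp
  have h1 := mul_le_mul_of_nonneg_left (Real.log_le_log hs' (by linarith : s ≤ s + t)) hs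
  have h2 := mul_le_mul_of_nonneg_left (Real.log_le_log ht' (by linarith : t ≤ s + t)) ht
  simp only [Real.negMulLog]
  linarith

/-- One term of Gibbs' inequality; the corrections `q - p` cancel when summed over two probability
laws. -/
lemma negMulLog_le_cross {p q : ℝ} (hp : 0 ≤ p) (hq : 0 ≤ q) (h : 0 < p → 0 < q) :
    Real.negMulLog p ≤ p * -Real.log q + q - p := by
  rcases hp.eq_or_lt with rfl | hp'
  · simpa using hq
  have hq' := h hp'
  have h1 := mul_le_mul_of_nonneg_left
    (Real.log_le_sub_one_of_pos (div_pos hq' hp')) hp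
  rw [Real.log_div hq'.ne' hp'.ne', mul_sub, mul_sub, mul_div_cancel₀ _ hp'.ne'] at h1
  simp only [Real.negMulLog]
  linarith

lemma entropy_sum_le {a b : ℝ} (ha0 : 0 ≤ a) (ha1 : a ≤ 1) (hb0 : 0 ≤ b) (hb1 : b ≤ 1) :
    Real.negMulLog ((1 - a) * (1 - b)) + Real.negMulLog (a * (1 - b) + (1 - a) * b) +
      Real.negMulLog (a * b) ≤ 3 / 2 * Real.log 2 := by
  have ha2 : 0 ≤ 1 - a := by linarith
  have hb2 : 0 ≤ 1 - b := by linarith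
  have hcross := crossEntropy_sumLaw_le ha0 ha1 hb0 hb1
  have hsum := sum_sumLaw ((a + b) / 2)
  rw [Fin.sum_univ_three] at hsum
  set c := (a + b) / 2 with hc
  have hnn := sumLaw_nonneg (c := c) (by positivity) (by rw [hc]; linarith)
  have h0 := negMulLog_le_cross (p := (1 - a) * (1 - b)) (by positivity) (hnn 0) (by
    intro h
    have : 0 < 1 - c := by
      by_contra hh
      have : a = 1 := by linarith
      simp [this] at h
    simp [sumLaw]; positivity)
  have h1 := negMulLog_le_cross (p := a * (1 - b) + (1 - a) * b) (by positivity) (hnn 1) (by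
    intro h
    have h2 : 0 < 1 - c := by
      by_contra hh
      have h1 : a = 1 := by linarith
      have h2 : b = 1 := by linarith
      simp [h1, h2] at h
    have h3 : 0 < c := by
      by_contra hh
      have h1 : a = 0 := by linarith
      have h2 : b = 0 := by linarith
      simp [h1, h2] at h
    simp [sumLaw]; positivity)
  have h2 := negMulLog_le_cross (p := a * b) (by positivity) (hnn 2) (by
    intro h
    have : 0 < c := by
      by_contra hh
      have : a = 0 := by linarith
      simp [this] at h
    simp [sumLaw]; positivity)
  nlinarith

/-- The hypotheses read `R₁ ≤ H(Z) - H(Y)` and `R₂ ≤ H(Y)`. Their sum is at most `H(Z) ≤ 3/2`, and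
merging the two preimages of `Z = 1` gives `H(Z) ≤ H(X) + H(Y)`, so `R₁ ≤ H(X) ≤ 1`. -/
lemma rates_le_of_entropy {a b R₁ R₂ : ℝ} (ha0 : 0 ≤ a) (ha1 : a ≤ 1) (hb0 : 0 ≤ b) (hb1 : b ≤ 1)
    (h₁ : R₁ ≤ (Real.negMulLog ((1 - a) * (1 - b)) + Real.negMulLog (a * (1 - b) + (1 - a) * b) +
      Real.negMulLog (a * b)) / Real.log 2 -
      (Real.negMulLog (1 - b) + Real.negMulLog b) / Real.log 2)
    (h₂ : R₂ ≤ (Real.negMulLog (1 - b) + Real.negMulLog b) / Real.log 2) :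
    R₁ ≤ 1 ∧ R₂ ≤ 1 ∧ R₁ + R₂ ≤ 3 / 2 := by
  have hlog : 0 < Real.log 2 := Real.log_pos (by norm_num)
  have ha2 : 0 ≤ 1 - a := by linarith
  have hb2 : 0 ≤ 1 - b := by linarith
  have hsum := entropy_sum_le ha0 ha1 hb0 hb1
  have hmerge := negMulLog_add_le (mul_nonneg ha0 hb2) (mul_nonneg ha2 hb0)
  have hbit : ∀ x : ℝ, Real.negMulLog (1 - x) + Real.negMulLog x ≤ Real.log 2 := fun x => by
    rw [add_comm, ← Real.binEntropy_eq_negMulLog_add_negMulLog_one_sub]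
    exact Real.binEntropy_le_log_two
  have hsplit : Real.negMulLog ((1 - a) * (1 - b)) + Real.negMulLog (a * (1 - b)) +
      Real.negMulLog ((1 - a) * b) + Real.negMulLog (a * b) =
      Real.negMulLog (1 - a) + Real.negMulLog a + (Real.negMulLog (1 - b) + Real.negMulLog b) := by
    simp only [Real.negMulLog_mul]; ring
  rw [← sub_div, le_div_iff₀ hlog] at h₁
  rw [le_div_iff₀ hlog] at h₂
  refine ⟨le_of_mul_le_mul_right ?_ hlog, le_of_mul_le_mul_right ?_ hlog,
    le_of_mul_le_mul_right ?_ hlog⟩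
  · linarith [hbit a]
  · linarith [hbit b]
  · linarith

lemma exists_eq_of_mem_stdSimplex {P : Fin 2 → ℝ} (h : P ∈ stdSimplex ℝ (Fin 2)) :
    0 ≤ P 1 ∧ P 1 ≤ 1 ∧ P 0 = 1 - P 1 := by
  have h0 := h.1 0
  have h1 := h.1 1
  have h2 := h.2
  rw [Fin.sum_univ_two] at h2
  refine ⟨h1, ?_, ?_⟩ <;> linarith

lemma rateRegion₁_subset {P₁ P₂ : Fin 2 → ℝ} (h₁ : P₁ ∈ stdSimplex ℝ (Fin 2))
    (h₂ : P₂ ∈ stdSimplex ℝ (Fin 2)) : rateRegion₁ erasureMAC P₁ P₂ ⊆ pentagon := by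
  rintro ⟨R₁, R₂⟩ ⟨hR₁, hR₂, k₁, k₂⟩
  obtain ⟨a0, a1, a2⟩ := exists_eq_of_mem_stdSimplex h₁
  obtain ⟨b0, b1, b2⟩ := exists_eq_of_mem_stdSimplex h₂
  have s₁ : P₁ 0 + P₁ 1 = 1 := by linarith
  have s₂ : P₂ 0 + P₂ 1 = 1 := by linarith
  have hmem := honestLaw_mem_jointLaws h₁ h₂
  replace k₁ := k₁ _ hmem
  replace k₂ := k₂ _ hmem (indep_honestLaw s₁ s₂)
  rw [mutualInfo_honestLaw_cX_cZ s₁ s₂, entropy, sum_negMulLog_law_honestLaw_cZ, a2, b2] at k₁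
  rw [condMutualInfo_honestLaw_cY_cZ_cX s₁ s₂, b2] at k₂
  obtain ⟨g₁, g₂, g₃⟩ := rates_le_of_entropy a0 a1 b0 b1 k₁ k₂
  exact ⟨hR₁, g₁, hR₂, g₂, g₃⟩

lemma rateRegion₂_subset {P₁ P₂ : Fin 2 → ℝ} (h₁ : P₁ ∈ stdSimplex ℝ (Fin 2))
    (h₂ : P₂ ∈ stdSimplex ℝ (Fin 2)) : rateRegion₂ erasureMAC P₁ P₂ ⊆ pentagon := by
  rintro ⟨R₁, R₂⟩ ⟨hR₁, hR₂, k₁, k₂⟩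
  obtain ⟨a0, a1, a2⟩ := exists_eq_of_mem_stdSimplex h₁
  obtain ⟨b0, b1, b2⟩ := exists_eq_of_mem_stdSimplex h₂
  have s₁ : P₁ 0 + P₁ 1 = 1 := by linarith
  have s₂ : P₂ 0 + P₂ 1 = 1 := by linarith
  have hmem := honestLaw_mem_jointLaws h₁ h₂
  replace k₁ := k₁ _ hmem (indep_honestLaw s₁ s₂)
  replace k₂ := k₂ _ hmem
  rw [mutualInfo_honestLaw_cY_cZ s₁ s₂, entropy, sum_negMulLog_law_honestLaw_cZ, a2, b2] at k₂
  rw [condMutualInfo_honestLaw_cX_cZ_cY s₁ s₂, a2] at k₁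
  -- `H(Z)` is symmetric in the two biases, so the same entropy lemma applies with the users
  -- exchanged.
  have e1 : P₁ 1 * (1 - P₂ 1) + (1 - P₁ 1) * P₂ 1 =
    P₂ 1 * (1 - P₁ 1) + (1 - P₂ 1) * P₁ 1 := by ring
  rw [mul_comm (1 - P₁ 1) (1 - P₂ 1), e1, mul_comm (P₁ 1) (P₂ 1)] at k₂
  obtain ⟨g₁, g₂, g₃⟩ := rates_le_of_entropy b0 b1 a0 a1 k₂ k₁
  exact ⟨hR₁, g₂, hR₂, g₁, by simpa only [add_comm] using g₃⟩

/-! ### Uniform inputs -/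

/-- With `q` the bias of the other input, `H(Z) = 1 + h(q)/2` and `H(X,Z) = 1 + h(q)`, so the
information is `1 - h(q)/2`. -/
lemma half_le_mutualInfo_of_uniform {Ω : Type} [Fintype Ω] {p : Ω → ℝ} {f : Ω → Fin 2}
    {g : Ω → Fin 3} {Q : Fin 2 → ℝ} (hQ : Q ∈ stdSimplex ℝ (Fin 2))
    (h : ∀ x z, law p (fun ω => (f ω, g ω)) (x, z) = ∑ y, 1 / 2 * Q y * erasureMAC.law x y z) :
    1 / 2 ≤ mutualInfo p f g := by
  have hlog : 0 < Real.log 2 := Real.log_pos (by norm_num)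
  obtain ⟨q0, q1, q2⟩ := exists_eq_of_mem_stdSimplex hQ
  have hf : ∀ x, law p f x = 1 / 2 := by
    intro x
    have := law_comp p (fun ω => (f ω, g ω)) Prod.fst x
    refine this.trans ?_
    fin_cases x <;> simp [Fintype.sum_prod_type, h, Fin.sum_univ_three, erasureMAC, q2] <;> ring
  have hg : ∀ z, law p g z = ![(1 - Q 1) / 2, 1 / 2, Q 1 / 2] z := by
    intro z
    have := law_comp p (fun ω => (f ω, g ω)) Prod.snd z
    refine this.trans ?_
    fin_cases z <;> simp [Fintype.sum_prod_type, h, erasureMAC, q2] <;> ring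
  have hhalf : Real.negMulLog (1 / 2) = 1 / 2 * Real.log 2 := by
    rw [Real.negMulLog, one_div, Real.log_inv]; ring
  have hdiv : ∀ t, Real.negMulLog (t / 2) = 1 / 2 * Real.negMulLog t + t * (1 / 2 * Real.log 2) := by
    intro t
    rw [div_eq_mul_one_div, Real.negMulLog_mul, hhalf]
  have hbit := Real.binEntropy_le_log_two (p := Q 1)
  rw [Real.binEntropy_eq_negMulLog_add_negMulLog_one_sub] at hbit
  rw [mutualInfo, entropy, entropy, entropy, ← add_div, ← sub_div, le_div_iff₀ hlog]
  simp only [Fintype.sum_prod_type, Fin.sum_univ_two, Fin.sum_univ_three, hf, hg, h, hhalf]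
  simp [erasureMAC, q2]
  simp only [← one_div, one_div_mul_eq_div, hdiv, Real.negMulLog_one]
  linarith

/-- The uniform distribution on the two input letters. -/
noncomputable def uniformBit : Fin 2 → ℝ := fun _ => 1 / 2

lemma uniformBit_mem : uniformBit ∈ stdSimplex ℝ (Fin 2) :=
  ⟨fun _ => by norm_num [uniformBit], by norm_num [uniformBit]⟩

section Uniform

variable {p : Quint (Fin 2) (Fin 2) (Fin 3) → ℝ}

lemma law_cX_cZ_of_mem {Q : Fin 2 → ℝ}
    (h : ∀ x y z, law p (fun ω => (cX ω, cY' ω, cZ ω)) (x, y, z) =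
      uniformBit x * Q y * erasureMAC.law x y z) (x : Fin 2) (z : Fin 3) :
    law p (fun ω => (cX ω, cZ ω)) (x, z) = ∑ y, 1 / 2 * Q y * erasureMAC.law x y z := by
  refine (law_comp p (fun ω => (cX ω, cY' ω, cZ ω)) (fun t => (t.1, t.2.2)) (x, z)).trans ?_
  simp only [Fintype.sum_prod_type, h, Prod.mk.injEq, ite_and, uniformBit]
  rw [Finset.sum_eq_single x (by intro b _ hb; simp [hb]) (by simp)]
  simp

lemma law_cY_cZ_of_mem {Q : Fin 2 → ℝ}
    (h : ∀ x y z, law p (fun ω => (cX' ω, cY ω, cZ ω)) (x, y, z) =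
      Q x * uniformBit y * erasureMAC.law x y z) (y : Fin 2) (z : Fin 3) :
    law p (fun ω => (cY ω, cZ ω)) (y, z) = ∑ x, 1 / 2 * Q x * erasureMAC.law y x z := by
  refine (law_comp p (fun ω => (cX' ω, cY ω, cZ ω)) (fun t => (t.2.1, t.2.2)) (y, z)).trans ?_
  simp only [Fintype.sum_prod_type, h, Prod.mk.injEq, ite_and, uniformBit]
  refine Finset.sum_congr rfl fun x _ => ?_
  rw [Finset.sum_eq_single y (by intro b _ hb; simp [hb]) (by simp)]
  simp [erasureMAC, add_comm, mul_comm]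

/-- When `x ≠ y` the supports of `(X,Z)` and `(Y,Z)` leave only `z = 1`, with mass 1/4. The masses
of `(X,Z)` at `(0,1)` and `(1,1)` are then at least 1/4, so both masses of `Q₂` are at least 1/2 and
`Q₂` is uniform. Nothing is left for `z = 1` when `x = y`. -/
lemma law_cX_cY_cZ_of_uniform (hp : p ∈ jointLaws erasureMAC uniformBit uniformBit)
    (hind : Indep p cX cY) (x y : Fin 2) (z : Fin 3) :
    law p (fun ω => (cX ω, cY ω, cZ ω)) (x, y, z) = 1 / 4 * erasureMAC.law x y z := by
  obtain ⟨hsimp, ⟨Q₂, hQ₂, h2⟩, Q₁, hQ₁, h1⟩ := hp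
  set T := fun x y z => law p (fun ω => (cX ω, cY ω, cZ ω)) (x, y, z) with hT
  have hnn : ∀ x y z, 0 ≤ T x y z := fun x y z => law_nonneg hsimp.1 _ _
  have hXZ : ∀ x z, ∑ y, T x y z = ∑ y, 1 / 2 * Q₂ y * erasureMAC.law x y z := by
    intro x z
    rw [← law_cX_cZ_of_mem h2,
      show law p (fun ω => (cX ω, cZ ω)) (x, z) = _ from
      law_comp p (fun ω => (cX ω, cY ω, cZ ω)) (fun t => (t.1, t.2.2)) (x, z)]
    simp only [Fintype.sum_prod_type, Prod.mk.injEq, ite_and]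
    symm
    rw [Finset.sum_eq_single x (by intro b _ hb; simp [hb]) (by simp)]
    simp [T]
  have hYZ : ∀ y z, ∑ x, T x y z = ∑ x, 1 / 2 * Q₁ x * erasureMAC.law y x z := by
    intro y z
    rw [← law_cY_cZ_of_mem h1,
      show law p (fun ω => (cY ω, cZ ω)) (y, z) = _ from
      law_comp p (fun ω => (cX ω, cY ω, cZ ω)) (fun t => (t.2.1, t.2.2)) (y, z)]
    simp only [Fintype.sum_prod_type, Prod.mk.injEq, ite_and]
    refine Finset.sum_congr rfl fun x _ => ?_
    rw [Finset.sum_eq_single y (by intro b _ hb; simp [hb]) (by simp)]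
    simp [T]
  obtain ⟨-, -, q2⟩ := exists_eq_of_mem_stdSimplex hQ₂
  obtain ⟨-, -, q1⟩ := exists_eq_of_mem_stdSimplex hQ₁
  have hX : ∀ x, law p cX x = 1 / 2 := by
    intro x
    refine (law_comp p (fun ω => (cX ω, cZ ω)) Prod.fst x).trans ?_
    fin_cases x <;> simp [Fintype.sum_prod_type, law_cX_cZ_of_mem h2, Fin.sum_univ_three,
      erasureMAC, q2] <;> ring
  have hY : ∀ y, law p cY y = 1 / 2 := by
    intro y
    refine (law_comp p (fun ω => (cY ω, cZ ω)) Prod.fst y).trans ?_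
    fin_cases y <;> simp [Fintype.sum_prod_type, law_cY_cZ_of_mem h1, Fin.sum_univ_three,
      erasureMAC, q1] <;> ring
  have hXY : ∀ x y, ∑ z, T x y z = 1 / 4 := by
    intro x y
    have h3 := hind x y
    rw [hX, hY, show law p (fun ω => (cX ω, cY ω)) (x, y) = _ from
      law_comp p (fun ω => (cX ω, cY ω, cZ ω)) (fun t => (t.1, t.2.1)) (x, y)] at h3
    simp only [Fintype.sum_prod_type, Prod.mk.injEq, ite_and] at h3
    rw [Finset.sum_eq_single x (by intro b _ hb; simp [hb]) (by simp),
      Finset.sum_eq_single y (by intro b _ hb; simp [hb]) (by simp)] at h3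
    simp only [if_true] at h3
    rw [h3]
    norm_num
  have e1 := hXZ 0 0; have e2 := hXZ 0 1; have e3 := hXZ 0 2
  have e4 := hXZ 1 0; have e5 := hXZ 1 1; have e6 := hXZ 1 2
  have f1 := hYZ 0 0; have f2 := hYZ 0 1; have f3 := hYZ 0 2
  have f4 := hYZ 1 0; have f5 := hYZ 1 1; have f6 := hYZ 1 2
  have g1 := hXY 0 0; have g2 := hXY 0 1; have g3 := hXY 1 0; have g4 := hXY 1 1
  simp [erasureMAC, q1, q2] at e1 e2 e3 e4 e5 e6 f1 f2 f3 f4 f5 f6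
  simp only [Fin.sum_univ_three] at g1 g2 g3 g4
  have n := hnn
  change T x y z = _
  fin_cases x <;> fin_cases y <;> fin_cases z <;> simp [erasureMAC] <;>
    linarith [n 0 0 0, n 0 0 1, n 0 0 2, n 0 1 0, n 0 1 1, n 0 1 2, n 1 0 0, n 1 0 1, n 1 0 2,
      n 1 1 0, n 1 1 1, n 1 1 2]

lemma entropy_comp_congr {Ω A B : Type} [Fintype Ω] [Fintype A] [DecidableEq A] [Fintype B]
    [DecidableEq B] {p p' : Ω → ℝ} {f : Ω → A} (h : ∀ a, law p f a = law p' f a) (g : A → B) :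
    entropy p (fun ω => g (f ω)) = entropy p' (fun ω => g (f ω)) := by
  simp only [entropy, law_comp, h]

/-- Only the law of `(X,Y,Z)` enters, and it is that of the honest law, where the value is the
entropy of a fair bit. -/
lemma condMutualInfo_uniform (hp : p ∈ jointLaws erasureMAC uniformBit uniformBit)
    (hind : Indep p cX cY) :
    condMutualInfo p cY cZ cX = 1 ∧ condMutualInfo p cX cZ cY = 1 := by
  have hlog : Real.log 2 ≠ 0 := (Real.log_pos (by norm_num)).ne'
  have hs : uniformBit 0 + uniformBit 1 = 1 := by norm_num [uniformBit]
  have hlaw : ∀ t : Fin 2 × Fin 2 × Fin 3, law p (fun ω => (cX ω, cY ω, cZ ω)) t =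
      law (honestLaw uniformBit uniformBit) (fun ω => (cX ω, cY ω, cZ ω)) t := by
    rintro ⟨x, y, z⟩
    rw [law_cX_cY_cZ_of_uniform hp hind, law_cX_cY_cZ_of_uniform
      (honestLaw_mem_jointLaws uniformBit_mem uniformBit_mem) (indep_honestLaw hs hs)]
  have hval : (Real.negMulLog (uniformBit 0) + Real.negMulLog (uniformBit 1)) / Real.log 2 = 1 := by
    have : Real.negMulLog (1 / 2) = 1 / 2 * Real.log 2 := by
      rw [Real.negMulLog, one_div, Real.log_inv]; ring
    simp only [uniformBit, this]
    field_simp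
    norm_num
  constructor
  · rw [← hval, ← condMutualInfo_honestLaw_cY_cZ_cX hs hs, condMutualInfo, condMutualInfo]
    congr 1
    · congr 1
      · congr 1
        · exact entropy_comp_congr hlaw fun t => (t.2.1, t.1)
        · exact entropy_comp_congr hlaw fun t => (t.2.2, t.1)
      · exact entropy_comp_congr hlaw fun t => (t.2.1, t.2.2, t.1)
    · exact entropy_comp_congr hlaw fun t => t.1
  · rw [← hval, ← condMutualInfo_honestLaw_cX_cZ_cY hs hs, condMutualInfo, condMutualInfo]
    congr 1
    · congr 1
      · congr 1
        · exact entropy_comp_congr hlaw fun t => (t.1, t.2.1)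
        · exact entropy_comp_congr hlaw fun t => (t.2.2, t.2.1)
      · exact entropy_comp_congr hlaw fun t => (t.1, t.2.2, t.2.1)
    · exact entropy_comp_congr hlaw fun t => t.2.1

end Uniform

lemma mem_rateRegion₁_uniform {R : ℝ × ℝ} (h0 : 0 ≤ R.1) (h1 : R.1 ≤ 1 / 2) (h2 : 0 ≤ R.2)
    (h3 : R.2 ≤ 1) : R ∈ rateRegion₁ erasureMAC uniformBit uniformBit := by
  refine ⟨h0, h2, fun p hp => h1.trans ?_, fun p hp hind =>
    h3.trans (condMutualInfo_uniform hp hind).1.ge⟩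
  obtain ⟨-, ⟨Q, hQ, h⟩, -⟩ := hp
  exact half_le_mutualInfo_of_uniform hQ (law_cX_cZ_of_mem h)

lemma mem_rateRegion₂_uniform {R : ℝ × ℝ} (h0 : 0 ≤ R.1) (h1 : R.1 ≤ 1) (h2 : 0 ≤ R.2)
    (h3 : R.2 ≤ 1 / 2) : R ∈ rateRegion₂ erasureMAC uniformBit uniformBit := by
  refine ⟨h0, h2, fun p hp hind => h1.trans (condMutualInfo_uniform hp hind).2.ge,
    fun p hp => h3.trans ?_⟩
  obtain ⟨-, -, Q, hQ, h⟩ := hp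
  exact half_le_mutualInfo_of_uniform hQ (law_cY_cZ_of_mem h)

theorem innerBound_erasureMAC : innerBound erasureMAC = pentagon := by
  refine Set.Subset.antisymm ?_ ?_
  · refine closure_minimal (convexHull_min ?_ convex_pentagon) isClosed_pentagon
    refine Set.iUnion₂_subset fun P₁ h₁ => Set.iUnion₂_subset fun P₂ h₂ => ?_
    exact Set.union_subset (rateRegion₁_subset h₁ h₂) (rateRegion₂_subset h₁ h₂)
  · refine Set.Subset.trans ?_ subset_closure
    refine pentagon_subset_of_convex (convex_convexHull ℝ _)
      (Set.Subset.trans ?_ (subset_convexHull ℝ _))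
    intro R hR
    refine Set.mem_iUnion₂.2 ⟨_, uniformBit_mem, Set.mem_iUnion₂.2 ⟨_, uniformBit_mem, ?_⟩⟩
    rcases hR with rfl | rfl | rfl | rfl | rfl
    · exact Or.inl (mem_rateRegion₁_uniform (by norm_num) (by norm_num) (by norm_num)
        (by norm_num))
    · exact Or.inr (mem_rateRegion₂_uniform (by norm_num) (by norm_num) (by norm_num)
        (by norm_num))
    · exact Or.inl (mem_rateRegion₁_uniform (by norm_num) (by norm_num) (by norm_num)
        (by norm_num))
    · exact Or.inl (mem_rateRegion₁_uniform (by norm_num) (by norm_num) (by norm_num)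
        (by norm_num))
    · exact Or.inr (mem_rateRegion₂_uniform (by norm_num) (by norm_num) (by norm_num)
        (by norm_num))

/-! ### Random codes: decoupling -/

section Decoupling

variable {I V : Type*} [Fintype I] [DecidableEq I] [Fintype V] [DecidableEq V]

omit [Fintype V] [DecidableEq V] in
-- A uniform random subset contains `k` and misses `l` with probability 1/4: forcing this is a map
-- with fibres of size at most 4.
lemma two_pow_card_le_four_mul {k l : I} (hkl : l ≠ k) :
    2 ^ Fintype.card I ≤ 4 * (Finset.univ.filter fun S : Finset I => k ∈ S ∧ l ∉ S).card := by
  rw [← Fintype.card_finset, ← Finset.card_univ]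
  refine Finset.card_le_mul_card_image_of_maps_to (f := fun S => insert k (S.erase l))
    (fun S _ => by simp [hkl]) 4 fun b _ => ?_
  have : (Finset.univ : Finset (Bool × Bool)).card = 4 := rfl
  rw [← this]
  refine Finset.card_le_card_of_injOn (fun S => (decide (k ∈ S), decide (l ∈ S)))
    (by simp) ?_
  intro S hS S' hS' h
  simp only [Finset.coe_filter, Finset.mem_univ, true_and, Set.mem_ofPred_eq] at hS hS'
  simp only [Prod.mk.injEq, decide_eq_decide] at h
  ext i
  by_cases hk : i = k
  · rw [hk]; exact h.1
  by_cases hl : i = l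
  · rw [hl]; exact h.2
  have := congrArg (i ∈ ·) (hS.trans hS'.symm)
  simpa [hk, hl] using this

omit [Fintype V] [DecidableEq V] in
/-- A fixed-point-free map sends some quarter of a finite set into its complement. -/
lemma exists_subset_disjoint_image (M : Finset I) (p : I → I) (hp : ∀ k ∈ M, p k ≠ k) :
    ∃ T ⊆ M, M.card ≤ 4 * T.card ∧ ∀ k ∈ T, p k ∉ T := by
  -- Averaging over a random `S`, a quarter of the `k ∈ M` have `k ∈ S` and `p k ∉ S`; some `S` does
  -- as well as the average.
  have hsum : ∑ _S : Finset I, M.card ≤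
      ∑ S : Finset I, 4 * (M.filter fun k => k ∈ S ∧ p k ∉ S).card := by
    simp only [Finset.card_filter, ← Finset.mul_sum]
    rw [Finset.sum_comm, Finset.sum_const, Finset.card_univ, Fintype.card_finset, smul_eq_mul,
      Finset.mul_sum, mul_comm, ← smul_eq_mul, ← Finset.sum_const]
    refine Finset.sum_le_sum fun k hk => ?_
    rw [← Finset.card_filter]
    exact two_pow_card_le_four_mul (hp k hk)
  obtain ⟨S, -, hS⟩ := Finset.exists_le_of_sum_le ⟨∅, Finset.mem_univ _⟩ hsum
  refine ⟨_, Finset.filter_subset _ _, hS, fun k hk hk' => ?_⟩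
  simp only [Finset.mem_filter] at hk hk'
  exact hk.2.2 hk'.2.1

/-- The words related to some codeword with index in `J`. -/
def hitSet (r : V → V → Prop) [DecidableRel r] (J : Finset I) (F : I → V) : Finset V :=
  {v | ∃ j ∈ J, r (F j) v}

/-- The indices in `K` whose codeword is related to a codeword with another index in `J`. -/
def badSet (r : V → V → Prop) [DecidableRel r] (J K : Finset I) (F : I → V) : Finset I :=
  {k ∈ K | ∃ j ∈ J, j ≠ k ∧ r (F j) (F k)}

/-- Condition on the codewords outside `T`. They fix the target set, of density at most `1/M`, and
the codewords in `T` fall into it independently. -/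
lemma card_forall_mem_mul_le (T : Finset I) (B : ({i // i ∉ T} → V) → Finset V) (M : ℕ) :
    (Finset.univ.filter fun F : I → V => (B fun i => F i).card * M ≤ Fintype.card V ∧
      ∀ k ∈ T, F k ∈ B fun i => F i).card * M ^ T.card ≤ Fintype.card V ^ Fintype.card I := by
  set S := Finset.univ.filter fun F : I → V => (B fun i => F i).card * M ≤ Fintype.card V ∧
      ∀ k ∈ T, F k ∈ B fun i => F i with hS
  rw [Finset.card_eq_sum_card_fiberwise (f := fun F (i : {i // i ∉ T}) => F i)
    (t := Finset.univ) (by simp), Finset.sum_mul]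
  have key : ∀ g : {i // i ∉ T} → V,
      (S.filter fun F => (fun i : {i // i ∉ T} => F i) = g).card * M ^ T.card ≤
        Fintype.card V ^ T.card := by
    intro g
    by_cases hg : (B g).card * M ≤ Fintype.card V
    · have h1 : (S.filter fun F => (fun i : {i // i ∉ T} => F i) = g).card ≤
          (Fintype.piFinset fun _ : {i // i ∈ T} => B g).card := by
        refine Finset.card_le_card_of_injOn (fun F i => F i) ?_ ?_
        · intro F hF
          simp only [hS, Finset.coe_filter, Finset.mem_filter, Finset.mem_univ, true_and,
            Set.mem_ofPred_eq] at hF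
          simp only [Finset.mem_coe, Fintype.mem_piFinset]
          intro i
          have := hF.1.2 i i.2
          rwa [hF.2] at this
        · intro F hF F' hF' h
          simp only [Finset.coe_filter, Set.mem_ofPred_eq] at hF hF'
          funext i
          by_cases hi : i ∈ T
          · exact congrFun h ⟨i, hi⟩
          · exact congrFun (hF.2.trans hF'.2.symm) ⟨i, hi⟩
      rw [Fintype.card_piFinset, Finset.prod_const, Finset.card_univ, Fintype.card_coe] at h1
      calc _ ≤ (B g).card ^ T.card * M ^ T.card := Nat.mul_le_mul_right _ h1
        _ = ((B g).card * M) ^ T.card := (mul_pow _ _ _).symm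
        _ ≤ _ := Nat.pow_le_pow_left hg _
    · rw [Finset.filter_eq_empty_iff.2, Finset.card_empty, zero_mul]
      · exact Nat.zero_le _
      · rintro F hF rfl
        simp only [hS, Finset.mem_filter, Finset.mem_univ, true_and] at hF
        exact hg hF.1
  refine (Finset.sum_le_sum fun g _ => key g).trans (le_of_eq ?_)
  rw [Finset.sum_const, Finset.card_univ, Fintype.card_fun, Fintype.card_subtype_compl,
    Fintype.card_coe, smul_eq_mul, ← pow_add, Nat.sub_add_cancel (Finset.card_le_univ T)]

/-- The events that different codewords are bad are dependent. Choosing a witness for each bad index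
and passing to a quarter of them gives a set `T` whose witnesses lie outside `T`, so that the
codewords in `T` must hit a small set independent of them. A union bound over the at most `2 ^ |K|`
sets `T` completes the count. -/
lemma card_badSet_large_mul_le (r : V → V → Prop) [DecidableRel r] (J K : Finset I) (q : ℕ) :
    (Finset.univ.filter fun F : I → V => (hitSet r J F).card * 2 ^ (8 * q) ≤ Fintype.card V ∧
      K.card ≤ q * (badSet r J K F).card).card * 2 ^ K.card ≤
      Fintype.card V ^ Fintype.card I := by
  let B : (T : Finset I) → ({i // i ∉ T} → V) → Finset V := fun T g =>
    Finset.univ.filter fun v => ∃ j : {i // i ∉ T}, j.1 ∈ J ∧ r (g j) v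
  let E : Finset I → Finset (I → V) := fun T =>
    Finset.univ.filter fun F : I → V => (B T fun i => F i).card * 2 ^ (8 * q) ≤ Fintype.card V ∧
      ∀ k ∈ T, F k ∈ B T fun i => F i
  have hE : ∀ T ∈ K.powerset.filter (fun T => K.card ≤ 4 * q * T.card),
      (E T).card * 2 ^ (2 * K.card) ≤ Fintype.card V ^ Fintype.card I := by
    intro T hT
    -- Since `|K| ≤ 4q|T|`, the gain `2 ^ (8q|T|)` is at least `2 ^ (2|K|)`; half of the exponent
    -- pays for the choice of `T`.
    refine le_trans (Nat.mul_le_mul_left _ ?_) (card_forall_mem_mul_le T (B T) (2 ^ (8 * q)))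
    rw [← pow_mul]
    refine Nat.pow_le_pow_right two_pos ?_
    have := (Finset.mem_filter.1 hT).2
    linarith
  have hsub : (Finset.univ.filter fun F : I → V =>
      (hitSet r J F).card * 2 ^ (8 * q) ≤ Fintype.card V ∧
        K.card ≤ q * (badSet r J K F).card) ⊆
      (K.powerset.filter fun T => K.card ≤ 4 * q * T.card).biUnion E := by
    intro F hF
    simp only [Finset.mem_filter, Finset.mem_univ, true_and] at hF
    have hbad : ∀ k, ∃ j, k ∈ badSet r J K F → j ∈ J ∧ j ≠ k ∧ r (F j) (F k) := by
      intro k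
      -- Outside the bad set the witness is an arbitrary default.
      by_cases hk : k ∈ badSet r J K F
      · obtain ⟨j, hj⟩ := (Finset.mem_filter.1 hk).2
        exact ⟨j, fun _ => hj⟩
      · exact ⟨k, fun h => absurd h hk⟩
    choose p hp using hbad
    obtain ⟨T, hTM, hcard, hdisj⟩ := exists_subset_disjoint_image (badSet r J K F) p
      fun k hk => (hp k hk).2.1
    refine Finset.mem_biUnion.2 ⟨T, ?_, ?_⟩
    · refine Finset.mem_filter.2 ⟨Finset.mem_powerset.2
        (hTM.trans (Finset.filter_subset _ _)), hF.2.trans ?_⟩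
      nlinarith [Nat.mul_le_mul_left q hcard]
    · refine Finset.mem_filter.2 ⟨Finset.mem_univ _, le_trans (Nat.mul_le_mul_right _
        (Finset.card_le_card ?_)) hF.1, fun k hk => ?_⟩
      · intro v hv
        obtain ⟨j, hj, hr⟩ := (Finset.mem_filter.1 hv).2
        exact Finset.mem_filter.2 ⟨Finset.mem_univ _, j, hj, hr⟩
      · obtain ⟨h1, -, h3⟩ := hp k (hTM hk)
        exact Finset.mem_filter.2 ⟨Finset.mem_univ _, ⟨p k, hdisj k hk⟩, h1, h3⟩
  have htot : (Finset.univ.filter fun F : I → V =>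
      (hitSet r J F).card * 2 ^ (8 * q) ≤ Fintype.card V ∧
        K.card ≤ q * (badSet r J K F).card).card * 2 ^ (2 * K.card) ≤
      2 ^ K.card * Fintype.card V ^ Fintype.card I := by
    refine (Nat.mul_le_mul_right _ ((Finset.card_le_card hsub).trans
      Finset.card_biUnion_le)).trans ?_
    rw [Finset.sum_mul]
    refine (Finset.sum_le_sum hE).trans ?_
    rw [Finset.sum_const, smul_eq_mul]
    refine Nat.mul_le_mul_right _ ((Finset.card_filter_le _ _).trans ?_)
    rw [Finset.card_powerset]
  refine Nat.le_of_mul_le_mul_left ?_ (Nat.two_pow_pos K.card)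
  calc _ = _ * 2 ^ (2 * K.card) := by rw [two_mul, pow_add]; ring
    _ ≤ _ := htot

end Decoupling

/-! ### Counting binary words -/

section Words

variable {n : ℕ}

/-- The coordinates in which two words agree. -/
def agreeSet (x v : Fin n → Fin 2) : Finset (Fin n) := {i | x i = v i}

lemma card_words_eq_on_mul (S : Finset (Fin n)) (x : Fin n → Fin 2) :
    (Finset.univ.filter fun u : Fin n → Fin 2 => ∀ i ∈ S, u i = x i).card * 2 ^ S.card = 2 ^ n := by
  have h : (Finset.univ.filter fun u : Fin n → Fin 2 => ∀ i ∈ S, u i = x i) =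
      Fintype.piFinset fun i => if i ∈ S then {x i} else Finset.univ := by
    ext u
    simp only [Finset.mem_filter, Finset.mem_univ, true_and, Fintype.mem_piFinset]
    refine forall_congr' fun i => ?_
    split_ifs with hi <;> simp [hi]
  have h2 : 2 ^ S.card = ∏ i, if i ∈ S then 2 else 1 := by
    rw [Finset.prod_ite_mem, Finset.univ_inter, Finset.prod_const]
  rw [h, Fintype.card_piFinset, h2, ← Finset.prod_mul_distrib]
  trans ∏ _i : Fin n, 2
  · refine Finset.prod_congr rfl fun i _ => ?_
    split_ifs <;> simp
  · simp

/-- Each unit of radius offers `n + 1` choices: flip one coordinate or none. -/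
lemma card_ball_le (u : Fin n → Fin 2) (d : ℕ) :
    (Finset.univ.filter fun v => hammingDist u v ≤ d).card ≤ (n + 1) ^ d := by
  induction d with
  | zero =>
    simp only [Nat.le_zero, hammingDist_eq_zero, pow_zero]
    rw [Finset.filter_eq]
    simp
  | succ d ih =>
    set b := Finset.univ.filter fun v => hammingDist u v ≤ d with hb
    let flip : (Fin n → Fin 2) × Option (Fin n) → Fin n → Fin 2 := fun w =>
      w.2.elim w.1 fun i => Function.update w.1 i (w.1 i + 1)
    have hsub : (Finset.univ.filter fun v => hammingDist u v ≤ d + 1) ⊆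
        (b ×ˢ Finset.univ).image flip := by
      intro v hv
      simp only [Finset.mem_filter, Finset.mem_univ, true_and] at hv
      by_cases huv : u = v
      · exact Finset.mem_image.2 ⟨(v, none), by simp [hb, huv], rfl⟩
      obtain ⟨i, hi⟩ := Function.ne_iff.1 huv
      refine Finset.mem_image.2 ⟨(Function.update v i (u i), some i), ?_, ?_⟩
      · simp only [hb, Finset.mem_product, Finset.mem_filter, Finset.mem_univ, true_and, and_true]
        refine Nat.lt_succ_iff.1 (lt_of_lt_of_le (Finset.card_lt_card ?_) hv)
        refine Finset.ssubset_iff_of_subset ?_ |>.2 ⟨i, by simpa using hi, by simp⟩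
        intro j hj
        simp only [Finset.mem_filter, Finset.mem_univ, true_and] at hj ⊢
        by_cases hji : j = i
        · rw [hji]; exact hi
        · rwa [Function.update_of_ne hji] at hj
      · simp only [flip, Option.elim_some, Function.update_self, Function.update_idem]
        have : u i + 1 = v i := by
          revert hi; generalize u i = a; generalize v i = c; revert a c; decide
        rw [this, Function.update_eq_self]
    calc _ ≤ ((b ×ˢ Finset.univ).image flip).card := Finset.card_le_card hsub
      _ ≤ (b ×ˢ (Finset.univ : Finset (Option (Fin n)))).card := Finset.card_image_le
      _ = b.card * (n + 1) := by simp
      _ ≤ _ := by rw [pow_succ]; exact Nat.mul_le_mul_right _ ih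

/-- Hoeffding's inequality for the agreement of a uniform word with a fixed word. -/
lemma card_agreeSet_small_le (x : Fin n → Fin 2) {δ : ℝ} (hδ : 0 ≤ δ) :
    ((Finset.univ.filter fun v => ((agreeSet x v).card : ℝ) ≤ n * (1 / 2 - δ)).card : ℝ) ≤
      2 ^ n * Real.exp (-(2 * δ ^ 2 * n)) := by
  set S := Finset.univ.filter fun v => ((agreeSet x v).card : ℝ) ≤ n * (1 / 2 - δ) with hS
  -- With these signs, small agreement means a sum of at least `2δn`. The exponential tilt `2δ`
  -- gains `4δ²n` and costs at most `2δ²n` through `cosh s ≤ exp (s²/2)`.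
  let s : Fin n → Fin 2 → ℝ := fun i b => if x i = b then -1 else 1
  have hs : ∀ v : Fin n → Fin 2, ∑ i, s i (v i) = n - 2 * (agreeSet x v).card := by
    intro v
    have : ∀ i, s i (v i) = 1 - 2 * (if x i = v i then (1 : ℝ) else 0) := by
      intro i; simp only [s]; split_ifs <;> norm_num
    simp only [this, Finset.sum_sub_distrib, ← Finset.mul_sum, agreeSet, Finset.card_filter]
    simp
  have htot : ∑ v : Fin n → Fin 2, Real.exp (2 * δ * ∑ i, s i (v i)) =
      (2 * Real.cosh (2 * δ)) ^ n := by
    have h1 : ∀ i, ∑ b, Real.exp (2 * δ * s i b) = 2 * Real.cosh (2 * δ) := by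
      intro i
      have : ∀ a : Fin 2, ∑ b, Real.exp (2 * δ * if a = b then -1 else 1) =
          2 * Real.cosh (2 * δ) := by
        intro a
        rw [Real.cosh_eq]
        fin_cases a <;> simp <;> ring
      exact this (x i)
    simp only [Finset.mul_sum, Real.exp_sum]
    have := Finset.prod_univ_sum (fun _ : Fin n => (Finset.univ : Finset (Fin 2)))
      fun i b => Real.exp (2 * δ * s i b)
    rw [Fintype.piFinset_univ] at this
    rw [← this]
    simp [h1]
  have hmarkov : (S.card : ℝ) * Real.exp (4 * δ ^ 2 * n) ≤ (2 * Real.cosh (2 * δ)) ^ n := by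
    rw [← htot, ← nsmul_eq_mul, ← Finset.sum_const]
    refine (Finset.sum_le_sum fun v hv => ?_).trans
      (Finset.sum_le_univ_sum_of_nonneg fun v => (Real.exp_pos _).le)
    have hv' := (Finset.mem_filter.1 hv).2
    rw [Real.exp_le_exp, hs]
    nlinarith
  have hcosh : (2 * Real.cosh (2 * δ)) ^ n ≤ 2 ^ n * Real.exp (2 * δ ^ 2 * n) := by
    rw [mul_pow]
    refine mul_le_mul_of_nonneg_left ?_ (by positivity)
    refine (pow_le_pow_left₀ (Real.cosh_pos _).le (Real.cosh_le_exp_half_sq _) n).trans ?_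
    rw [← Real.exp_nat_mul]
    exact le_of_eq (by ring_nf)
  have h := hmarkov.trans hcosh
  rw [← le_div_iff₀ (Real.exp_pos _), mul_div_assoc, ← Real.exp_sub] at h
  refine h.trans (le_of_eq ?_)
  congr 2
  ring

end Words

/-! ### Random codes: the exponential moment -/

lemma two_rpow_le_one_add {y : ℝ} (h0 : 0 ≤ y) (h1 : y ≤ 1) : (2 : ℝ) ^ y ≤ 1 + y := by
  have := rpow_one_add_le_one_add_mul_self (s := 1) (by norm_num) h0 h1
  norm_num at this
  exact this

/-- Markov's inequality for `2` to the sum: each factor has mean at most `1 + β`, so the product has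
mean at most `exp (|J|β) ≤ e ≤ 4`. -/
lemma card_sum_large_mul_le {I V : Type*} [Fintype I] [DecidableEq I] [Fintype V]
    (J : Finset I) (y : V → ℝ) (h0 : ∀ u, 0 ≤ y u) (h1 : ∀ u, y u ≤ 1) {β : ℝ}
    (hβ0 : 0 ≤ β) (hβ : ∑ u, y u ≤ β * Fintype.card V) (hJ : J.card * β ≤ 1) (m : ℕ) :
    ((Finset.univ.filter fun F : I → V => (m : ℝ) ≤ ∑ j ∈ J, y (F j)).card : ℝ) * 2 ^ m ≤
      4 * Fintype.card V ^ Fintype.card I := by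
  have htot : ∑ F : I → V, ∏ i, (if i ∈ J then (2 : ℝ) ^ y (F i) else 1) ≤
      4 * Fintype.card V ^ Fintype.card I := by
    have hprod : ∑ F : I → V, ∏ i, (if i ∈ J then (2 : ℝ) ^ y (F i) else 1) =
        ∏ i : I, ∑ u, (if i ∈ J then (2 : ℝ) ^ y u else 1) := by
      rw [Finset.prod_univ_sum, Fintype.piFinset_univ]
    have hfac : ∀ i, ∑ u, (if i ∈ J then (2 : ℝ) ^ y u else 1) ≤
        Fintype.card V * (if i ∈ J then 1 + β else 1) := by
      intro i
      split_ifs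
      · calc ∑ u, (2 : ℝ) ^ y u ≤ ∑ u, (1 + y u) :=
              Finset.sum_le_sum fun u _ => two_rpow_le_one_add (h0 u) (h1 u)
          _ = Fintype.card V + ∑ u, y u := by simp [Finset.sum_add_distrib]
          _ ≤ _ := by linarith
      · simp
    rw [hprod]
    refine (Finset.prod_le_prod (fun i _ => Finset.sum_nonneg fun u _ => ?_)
      fun i _ => hfac i).trans ?_
    · split_ifs <;> positivity
    rw [Finset.prod_mul_distrib, Finset.prod_const, Finset.card_univ, Finset.prod_ite_mem,
      Finset.univ_inter, Finset.prod_const, mul_comm]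
    refine mul_le_mul_of_nonneg_right ?_ (by positivity)
    calc (1 + β) ^ J.card ≤ Real.exp β ^ J.card :=
          pow_le_pow_left₀ (by positivity) (by linarith [Real.add_one_le_exp β]) _
      _ = Real.exp (J.card * β) := (Real.exp_nat_mul _ _).symm
      _ ≤ Real.exp 1 := Real.exp_le_exp.2 hJ
      _ ≤ 4 := by linarith [Real.exp_one_lt_d9]
  refine le_trans ?_ htot
  rw [← nsmul_eq_mul, ← Finset.sum_const]
  refine (Finset.sum_le_sum fun F hF => ?_).trans
    (Finset.sum_le_univ_sum_of_nonneg fun F => Finset.prod_nonneg fun i _ => ?_)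
  · rw [Finset.prod_ite_mem, Finset.univ_inter, ← Real.rpow_sum_of_pos two_pos,
      ← Real.rpow_natCast]
    exact Real.rpow_le_rpow_of_exponent_le (by norm_num) (Finset.mem_filter.1 hF).2
  · split_ifs <;> positivity

/-! ### Random codebooks -/

/-- When one user sends `x` and the other sends `v`, the word `u` at distance more than `t` from
`x` is compatible with the channel output. -/
def Confuses {n : ℕ} (t : ℕ) (x u v : Fin n → Fin 2) : Prop :=
  t < hammingDist u x ∧ ∀ i, x i = v i → u i = x i

instance {n : ℕ} (t : ℕ) (x : Fin n → Fin 2) : DecidableRel (Confuses t x) := fun u v =>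
  inferInstanceAs (Decidable (t < hammingDist u x ∧ ∀ i, x i = v i → u i = x i))

section Codebooks

variable {n : ℕ}

/-- For fixed `u`, the word `v` must differ from `x`, hence equal `u`, on the more than `t` places
where `u ≠ x`. -/
lemma card_confuses_mul_le (t : ℕ) (x u : Fin n → Fin 2) :
    (Finset.univ.filter fun v => Confuses t x u v).card * 2 ^ t ≤ 2 ^ n := by
  by_cases ht : t < hammingDist u x
  · set D : Finset (Fin n) := {i | u i ≠ x i} with hD
    rw [← card_words_eq_on_mul D u]
    refine Nat.mul_le_mul (Finset.card_le_card fun v hv => ?_)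
      (Nat.pow_le_pow_right two_pos ht.le)
    simp only [Finset.mem_filter, Finset.mem_univ, true_and, hD] at hv ⊢
    intro i hi
    have h1 : x i ≠ v i := fun h => hi (hv.2 i h)
    revert hi h1
    generalize u i = a; generalize v i = b; generalize x i = c
    revert a b c; decide
  · rw [Finset.filter_eq_empty_iff.2 fun v _ hv => ht hv.1]
    simp

/-- Counting from the other side: for fixed `v`, the word `u` is prescribed on the at least `k`
places where `x` and `v` agree. -/
lemma sum_card_confuses_mul_le (t k : ℕ) (x : Fin n → Fin 2) :
    (∑ u, (Finset.univ.filter fun v => k ≤ (agreeSet x v).card ∧ Confuses t x u v).card) * 2 ^ k ≤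
      2 ^ n * 2 ^ n := by
  have h : ∑ u, (Finset.univ.filter fun v => k ≤ (agreeSet x v).card ∧ Confuses t x u v).card =
      ∑ v, (Finset.univ.filter fun u => k ≤ (agreeSet x v).card ∧ Confuses t x u v).card := by
    simp only [Finset.card_filter]
    exact Finset.sum_comm
  have hv : ∀ v, (Finset.univ.filter fun u =>
      k ≤ (agreeSet x v).card ∧ Confuses t x u v).card * 2 ^ k ≤ 2 ^ n := by
    intro v
    by_cases hk : k ≤ (agreeSet x v).card
    · rw [← card_words_eq_on_mul (agreeSet x v) x]
      refine Nat.mul_le_mul (Finset.card_le_card fun u hu => ?_)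
        (Nat.pow_le_pow_right two_pos hk)
      refine Finset.mem_filter.2 ⟨Finset.mem_univ _, fun i hi => ?_⟩
      exact (Finset.mem_filter.1 hu).2.2.2 i (Finset.mem_filter.1 hi).2
    · simp [hk]
  rw [h, Finset.sum_mul]
  refine (Finset.sum_le_sum fun v _ => hv v).trans (le_of_eq ?_)
  simp

variable {I : Type*} [Fintype I] [DecidableEq I]

/-- The hit set is at most the few words of low agreement with `x` plus a sum of independent
contributions, one per codeword. Each contribution is bounded by the first confusion count, its mean
by the second, so the exponential moment bound applies. -/
lemma card_hitSet_large_mul_le (x : Fin n → Fin 2) (J : Finset I) {k t q m : ℕ}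
    (hlow : (Finset.univ.filter fun v => (agreeSet x v).card < k).card * 2 ^ (8 * q + 1) ≤ 2 ^ n)
    (hJ : J.card * 2 ^ t ≤ 2 ^ k) (hm : m * 2 ^ (8 * q + 1) ≤ 2 ^ t) :
    (Finset.univ.filter fun F : I → Fin n → Fin 2 =>
      2 ^ n < (hitSet (Confuses t x) J F).card * 2 ^ (8 * q)).card * 2 ^ m ≤
      4 * (2 ^ n) ^ Fintype.card I := by
  let w : (Fin n → Fin 2) → ℕ := fun u =>
    (Finset.univ.filter fun v => k ≤ (agreeSet x v).card ∧ Confuses t x u v).card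
  -- Normalised to `[0, 1]`; the mean is then at most `2 ^ t / 2 ^ k`, the `β` used below.
  let y : (Fin n → Fin 2) → ℝ := fun u => w u * 2 ^ t / 2 ^ n
  have hV : (Fintype.card (Fin n → Fin 2) : ℝ) = 2 ^ n := by simp
  have hw : ∀ u, w u * 2 ^ t ≤ 2 ^ n := fun u =>
    (Nat.mul_le_mul_right _ (Finset.card_le_card
      (Finset.monotone_filter_right _ fun v _ hv => hv.2))).trans (card_confuses_mul_le t x u)
  have key := card_sum_large_mul_le (I := I) J y (fun u => by positivity)
    (fun u => by
      simp only [y]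
      rw [div_le_one (by positivity)]
      exact_mod_cast hw u)
    (β := 2 ^ t / 2 ^ k) (by positivity)
    (by
      have h := sum_card_confuses_mul_le t k x
      have h' : (∑ u, (w u : ℝ)) * 2 ^ k ≤ 2 ^ n * 2 ^ n := by exact_mod_cast h
      simp only [y]
      rw [← Finset.sum_div, ← Finset.sum_mul, hV, div_le_iff₀ (by positivity), div_mul_eq_mul_div,
        div_mul_eq_mul_div, le_div_iff₀ (by positivity)]
      calc (∑ u, (w u : ℝ)) * 2 ^ t * 2 ^ k = 2 ^ t * ((∑ u, (w u : ℝ)) * 2 ^ k) := by ring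
        _ ≤ 2 ^ t * (2 ^ n * 2 ^ n) := mul_le_mul_of_nonneg_left h' (by positivity)
        _ = _ := by ring)
    (by
      rw [← mul_div_assoc, div_le_one (by positivity)]
      exact_mod_cast hJ) m
  rw [hV] at key
  have hsub : (Finset.univ.filter fun F : I → Fin n → Fin 2 =>
      2 ^ n < (hitSet (Confuses t x) J F).card * 2 ^ (8 * q)) ⊆
      Finset.univ.filter fun F : I → Fin n → Fin 2 => (m : ℝ) ≤ ∑ j ∈ J, y (F j) := by
    intro F hF
    simp only [Finset.mem_filter, Finset.mem_univ, true_and] at hF ⊢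
    have hhit : (hitSet (Confuses t x) J F).card ≤
        (Finset.univ.filter fun v => (agreeSet x v).card < k).card + ∑ j ∈ J, w (F j) := by
      refine (Finset.card_le_card (t := (Finset.univ.filter fun v => (agreeSet x v).card < k) ∪
        J.biUnion fun j => Finset.univ.filter fun v =>
          k ≤ (agreeSet x v).card ∧ Confuses t x (F j) v) fun v hv => ?_).trans
        ((Finset.card_union_le _ _).trans (Nat.add_le_add_left Finset.card_biUnion_le _))
      simp only [hitSet, Finset.mem_union, Finset.mem_biUnion, Finset.mem_filter, Finset.mem_univ,
        true_and] at hv ⊢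
      obtain ⟨j, hj, hc⟩ := hv
      rcases lt_or_ge (agreeSet x v).card k with h | h
      exacts [Or.inl h, Or.inr ⟨j, hj, h, hc⟩]
    have hsum : m * 2 ^ n ≤ (∑ j ∈ J, w (F j)) * 2 ^ t := by
      -- Words of low agreement account for at most half of the threshold `2 ^ (n - 8q)`, so the
      -- contributions supply the other half.
      have h1 : 2 ^ n ≤ (∑ j ∈ J, w (F j)) * 2 ^ (8 * q + 1) := by
        have := Nat.mul_le_mul_right (2 ^ (8 * q + 1)) hhit
        have h2 : (2 : ℕ) ^ (8 * q + 1) = 2 * 2 ^ (8 * q) := by rw [pow_succ, mul_comm]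
        rw [add_mul] at this
        nlinarith
      calc m * 2 ^ n ≤ m * ((∑ j ∈ J, w (F j)) * 2 ^ (8 * q + 1)) := Nat.mul_le_mul_left _ h1
        _ = (∑ j ∈ J, w (F j)) * (m * 2 ^ (8 * q + 1)) := by ring
        _ ≤ _ := Nat.mul_le_mul_left _ hm
    simp only [y]
    rw [← Finset.sum_div, ← Finset.sum_mul, le_div_iff₀ (by positivity)]
    exact_mod_cast hsum
  have hcard := Finset.card_le_card hsub
  have : ((Finset.univ.filter fun F : I → Fin n → Fin 2 =>
      2 ^ n < (hitSet (Confuses t x) J F).card * 2 ^ (8 * q)).card : ℝ) * 2 ^ m ≤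
      4 * (2 ^ n) ^ Fintype.card I :=
    (mul_le_mul_of_nonneg_right (by exact_mod_cast hcard) (by positivity)).trans key
  exact_mod_cast this

/-- Two words are within distance `d`. -/
def Near (d : ℕ) (u v : Fin n → Fin 2) : Prop := hammingDist u v ≤ d

instance (d : ℕ) : DecidableRel (Near (n := n) d) := fun u v =>
  inferInstanceAs (Decidable (hammingDist u v ≤ d))

omit [Fintype I] [DecidableEq I] in
lemma card_hitSet_near_le (d : ℕ) (J : Finset I) (F : I → Fin n → Fin 2) :
    (hitSet (Near d) J F).card ≤ J.card * (n + 1) ^ d := by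
  have h : hitSet (Near d) J F ⊆ J.biUnion fun j =>
      Finset.univ.filter fun v => hammingDist (F j) v ≤ d := by
    intro v hv
    obtain ⟨j, hj, hr⟩ := (Finset.mem_filter.1 hv).2
    exact Finset.mem_biUnion.2 ⟨j, hj, Finset.mem_filter.2 ⟨Finset.mem_univ _, hr⟩⟩
  refine (Finset.card_le_card h).trans (Finset.card_biUnion_le.trans ?_)
  refine (Finset.sum_le_sum fun j _ => card_ball_le (F j) d).trans (le_of_eq ?_)
  rw [Finset.sum_const, smul_eq_mul]

omit [DecidableEq I] in
lemma card_biUnion_words_mul_le {E : (Fin n → Fin 2) → Finset (I → Fin n → Fin 2)} {s P : ℕ}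
    (hs : n + 3 ≤ s) (h : ∀ x, (E x).card * 2 ^ s ≤ P) :
    (Finset.univ.biUnion E).card * 8 ≤ P := by
  refine Nat.le_of_mul_le_mul_left ?_ (Nat.two_pow_pos n)
  calc 2 ^ n * ((Finset.univ.biUnion E).card * 8)
      = (Finset.univ.biUnion E).card * 2 ^ (n + 3) := by rw [pow_add]; ring
    _ ≤ (∑ x, (E x).card) * 2 ^ (n + 3) := Nat.mul_le_mul_right _ Finset.card_biUnion_le
    _ = ∑ x, (E x).card * 2 ^ (n + 3) := Finset.sum_mul _ _ _
    _ ≤ ∑ _x : Fin n → Fin 2, P := Finset.sum_le_sum fun x _ =>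
        (Nat.mul_le_mul_left _ (Nat.pow_le_pow_right two_pos hs)).trans (h x)
    _ = _ := by simp

/-- A random `F` fails through one of five events, each of probability at most 1/8: some hit set is
too large, or one of the four bad sets is too large although its hit set is small. At least `n + 3`
codewords in `J` and in `K` are needed to beat the `2 ^ n` words `x`. -/
lemma exists_codebooks (J K : Finset I) {k t q : ℕ}
    (hlow : ∀ x : Fin n → Fin 2,
      (Finset.univ.filter fun v => (agreeSet x v).card < k).card * 2 ^ (8 * q + 1) ≤ 2 ^ n)
    (hJ : J.card * 2 ^ t ≤ 2 ^ k) (ht : (n + 5) * 2 ^ (8 * q + 1) ≤ 2 ^ t)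
    (hK : K.card * (n + 1) ^ (2 * t) * 2 ^ (8 * q) ≤ 2 ^ n)
    (hJ' : n + 3 ≤ J.card) (hK' : n + 3 ≤ K.card) :
    ∃ F : I → Fin n → Fin 2,
      (∀ x, q * (badSet (Confuses t x) J K F).card < K.card) ∧
      (∀ x, q * (badSet (Confuses t x) J J F).card < J.card) ∧
      q * (badSet (Near (2 * t)) K K F).card < K.card ∧
      q * (badSet (Near (2 * t)) K J F).card < J.card := by
  by_contra! hcon
  set P := (2 ^ n) ^ Fintype.card I with hP
  have hV : Fintype.card (Fin n → Fin 2) = 2 ^ n := by simp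
  let U₀ : (Fin n → Fin 2) → Finset (I → Fin n → Fin 2) := fun x => Finset.univ.filter fun F =>
    2 ^ n < (hitSet (Confuses t x) J F).card * 2 ^ (8 * q)
  let U : ((Fin n → Fin 2) → (Fin n → Fin 2) → Prop) → Finset I → Finset I →
      Finset (I → Fin n → Fin 2) := fun r L M => by
    classical
    exact Finset.univ.filter fun F => (hitSet r L F).card * 2 ^ (8 * q) ≤ 2 ^ n ∧
      M.card ≤ q * (badSet r L M F).card
  have hU : ∀ r L M, (U r L M).card * 2 ^ M.card ≤ P := by
    classical
    intro r L M
    have := card_badSet_large_mul_le (I := I) r L M q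
    rw [hV] at this
    convert this
  have h0 : (Finset.univ.biUnion U₀).card * 8 ≤ P := by
    refine card_biUnion_words_mul_le le_rfl fun x => ?_
    have : (U₀ x).card * 2 ^ (n + 5) ≤ 4 * P := card_hitSet_large_mul_le x J (hlow x) hJ ht
    rw [show n + 5 = n + 3 + 2 from rfl, pow_add, ← mul_assoc] at this
    linarith
  have h1 := card_biUnion_words_mul_le hK' fun x => hU (Confuses t x) J K
  have h2 := card_biUnion_words_mul_le hJ' fun x => hU (Confuses t x) J J
  -- Nearness does not involve `x`; the union over words is a dummy that reuses the same bound.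
  have h3 := card_biUnion_words_mul_le hK' fun _ => hU (Near (2 * t)) K K
  have h4 := card_biUnion_words_mul_le hJ' fun _ => hU (Near (2 * t)) K J
  have hcover : (Finset.univ : Finset (I → Fin n → Fin 2)) ⊆
      Finset.univ.biUnion U₀ ∪ ((Finset.univ.biUnion fun x : Fin n → Fin 2 => U (Confuses t x) J K) ∪
      ((Finset.univ.biUnion fun x : Fin n → Fin 2 => U (Confuses t x) J J) ∪
      ((Finset.univ.biUnion fun _ : Fin n → Fin 2 => U (Near (2 * t)) K K) ∪
      (Finset.univ.biUnion fun _ : Fin n → Fin 2 => U (Near (2 * t)) K J)))) := by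
    intro F _
    simp only [Finset.mem_union, Finset.mem_biUnion, Finset.mem_univ, true_and]
    by_cases hF0 : ∃ x, F ∈ U₀ x
    · exact Or.inl hF0
    have hhit : ∀ x, (hitSet (Confuses t x) J F).card * 2 ^ (8 * q) ≤ 2 ^ n := by
      intro x
      by_contra hx
      exact hF0 ⟨x, Finset.mem_filter.2 ⟨Finset.mem_univ _, not_le.1 hx⟩⟩
    have hnear : (hitSet (Near (2 * t)) K F).card * 2 ^ (8 * q) ≤ 2 ^ n :=
      (Nat.mul_le_mul_right _ (card_hitSet_near_le (2 * t) K F)).trans hK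
    have hmem : ∀ (r : (Fin n → Fin 2) → (Fin n → Fin 2) → Prop) [DecidableRel r] (L M : Finset I),
        (hitSet r L F).card * 2 ^ (8 * q) ≤ 2 ^ n → M.card ≤ q * (badSet r L M F).card →
        F ∈ U r L M := by
      intro r _ L M h h'
      simp only [U, Finset.mem_filter, Finset.mem_univ, true_and]
      constructor
      · convert h
      · convert h'
    by_cases hF1 : ∃ x, K.card ≤ q * (badSet (Confuses t x) J K F).card
    · obtain ⟨x, hx⟩ := hF1
      exact Or.inr (Or.inl ⟨x, hmem _ _ _ (hhit x) hx⟩)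
    by_cases hF2 : ∃ x, J.card ≤ q * (badSet (Confuses t x) J J F).card
    · obtain ⟨x, hx⟩ := hF2
      exact Or.inr (Or.inr (Or.inl ⟨x, hmem _ _ _ (hhit x) hx⟩))
    by_cases hF3 : K.card ≤ q * (badSet (Near (2 * t)) K K F).card
    · exact Or.inr (Or.inr (Or.inr (Or.inl ⟨0, hmem _ _ _ hnear hF3⟩)))
    push Not at hF1 hF2 hF3
    exact Or.inr (Or.inr (Or.inr (Or.inr
      ⟨0, hmem _ _ _ hnear (hcon F hF1 hF2 hF3)⟩)))
  have hcard := Finset.card_le_card hcover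
  have hle := hcard.trans ((Finset.card_union_le _ _).trans (Nat.add_le_add_left
    ((Finset.card_union_le _ _).trans (Nat.add_le_add_left ((Finset.card_union_le _ _).trans
      (Nat.add_le_add_left (Finset.card_union_le _ _) _)) _)) _))
  rw [Finset.card_univ, Fintype.card_fun, hV, ← hP] at hle
  have hPpos : 0 < P := by positivity
  -- The five events together cover at most 5/8 of all codebooks.
  omega

end Codebooks

/-! ### Adversary identifying codes for the adder with arbitrary message and index sets -/

/-- The possible outputs of an adversary identifying decoder. -/
inductive Outcome (A B : Type) where
  | messages (a : A) (b : B)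
  | blameOne
  | blameTwo

namespace Outcome

variable {A B : Type}

/-- The outcome is acceptable when user 1 is adversarial and user 2 sends `b`. -/
def OkOne (b : B) (o : Outcome A B) : Prop := o = blameOne ∨ ∃ a, o = messages a b

/-- The outcome is acceptable when user 2 is adversarial and user 1 sends `a`. -/
def OkTwo (a : A) (o : Outcome A B) : Prop := o = blameTwo ∨ ∃ b, o = messages a b

end Outcome

open Classical in
/-- There is an adversary identifying code for the adder, with message sets `A` and `B` and
coordinates indexed by `ι`, all of whose error probabilities are at most `ε`. -/
def HasCode (A B ι : Type) [Fintype A] [Fintype B] (ε : ℝ) : Prop :=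
  ∃ (f₁ : A → ι → Fin 2) (f₂ : B → ι → Fin 2) (dec : (ι → Fin 3) → Outcome A B),
    ((Finset.univ.filter fun p : A × B =>
      dec (addOut (f₁ p.1) (f₂ p.2)) ≠ .messages p.1 p.2).card : ℝ) ≤
        ε * (Fintype.card A * Fintype.card B) ∧
    (∀ x, ((Finset.univ.filter fun b => ¬ (dec (addOut x (f₂ b))).OkOne b).card : ℝ) ≤
      ε * Fintype.card B) ∧
    ∀ y, ((Finset.univ.filter fun a => ¬ (dec (addOut (f₁ a) y)).OkTwo a).card : ℝ) ≤
      ε * Fintype.card A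

/-! ### Symmetry between the users. -/

section Swap

variable {A B : Type}

/-- Exchange the roles of the two users. -/
def Outcome.swap : Outcome A B → Outcome B A
  | .messages a b => .messages b a
  | .blameOne => .blameTwo
  | .blameTwo => .blameOne

lemma Outcome.swap_eq_messages {o : Outcome A B} {a : A} {b : B} :
    o.swap = .messages b a ↔ o = .messages a b := by
  cases o <;> simp [Outcome.swap, and_comm]

lemma Outcome.okOne_swap {o : Outcome A B} {a : A} : o.swap.OkOne a ↔ o.OkTwo a := by
  cases o <;> simp [Outcome.swap, Outcome.OkOne, Outcome.OkTwo]

lemma Outcome.okTwo_swap {o : Outcome A B} {b : B} : o.swap.OkTwo b ↔ o.OkOne b := by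
  cases o <;> simp [Outcome.swap, Outcome.OkOne, Outcome.OkTwo]

lemma HasCode.swap {ι : Type} [Fintype A] [Fintype B] {ε : ℝ} (h : HasCode A B ι ε) : HasCode B A ι ε := by
  classical
  obtain ⟨f₁, f₂, dec, h0, h1, h2⟩ := h
  refine ⟨f₂, f₁, fun z => (dec z).swap, ?_, fun x => ?_, fun y => ?_⟩
  · rw [mul_comm (Fintype.card B : ℝ)]
    refine le_trans ?_ h0
    norm_cast
    refine Finset.card_le_card_of_injOn Prod.swap ?_ Prod.swap_injective.injOn
    intro p hp
    simp only [Finset.coe_filter, Finset.mem_univ, true_and, Set.mem_ofPred_eq, Prod.fst_swap,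
      Prod.snd_swap] at hp ⊢
    rw [addOut_comm]
    exact fun h => hp (Outcome.swap_eq_messages.2 h)
  · simp only [Outcome.okOne_swap, addOut_comm x]
    convert h2 x
  · simp only [Outcome.okTwo_swap, addOut_comm _ y]
    convert h1 y

end Swap

/-! ### The decoder -/

section Decoder

variable {n : ℕ}

/-- The word `u` may have been sent by one of the users when the output is `z`. -/
def Compat (u : Fin n → Fin 2) (z : Fin n → Fin 3) : Prop := ∃ w, addOut u w = z

/-- An output 0 or 2 reveals both input letters, so compatibility forces agreement with `x` wherever
`x` and `v` agree; the only way left to be far from `x` is a confusion. -/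
lemma Compat.hammingDist_le {t : ℕ} {u x v : Fin n → Fin 2} (h : Compat u (addOut x v))
    (hc : ¬ Confuses t x u v) : hammingDist u x ≤ t := by
  obtain ⟨w, hw⟩ := h
  by_contra ht
  refine hc ⟨not_le.1 ht, fun i hi => ?_⟩
  have h := congrFun hw i
  simp only [addOut, Fin.ext_iff] at h hi ⊢
  omega

lemma hammingDist_le_of_addOut {s t : ℕ} {u b x v : Fin n → Fin 2} (h : hammingDist u x ≤ s)
    (h' : hammingDist (addOut u b) (addOut x v) ≤ t) : hammingDist b v ≤ s + t := by
  refine le_trans (Finset.card_le_card fun i hi => ?_) ((Finset.card_union_le _ _).trans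
    (Nat.add_le_add h h'))
  simp only [Finset.mem_union, Finset.mem_filter, Finset.mem_univ, true_and] at hi ⊢
  by_contra! hcon
  exact hi ((addOut_apply_right_inj (x := u)).1
    (hcon.2.trans (addOut_apply_left_inj.2 hcon.1.symm)))

lemma hammingDist_addOut_right (u x v : Fin n → Fin 2) :
    hammingDist (addOut u v) (addOut x v) = hammingDist u x := by
  simp only [hammingDist, ne_eq, addOut_apply_left_inj]

variable {A B : Type} (f₁ : A → Fin n → Fin 2) (f₂ : B → Fin n → Fin 2) (t : ℕ)

/-- A message pair is plausible if both codewords are compatible with the output and their sum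
differs from the output in at most `t` places. -/
def Plausible (p : A × B) (z : Fin n → Fin 3) : Prop :=
  Compat (f₁ p.1) z ∧ Compat (f₂ p.2) z ∧ hammingDist (addOut (f₁ p.1) (f₂ p.2)) z ≤ t

open Classical in
/-- The decoder: output a plausible pair if there is one, else blame user 2 if some codeword of
user 1 is compatible with the output, and user 1 otherwise. -/
noncomputable def decode (z : Fin n → Fin 3) : Outcome A B :=
  if h : ∃ p, Plausible f₁ f₂ t p z then .messages h.choose.1 h.choose.2
  else if ∃ a, Compat (f₁ a) z then .blameTwo else .blameOne

variable {f₁ f₂ t}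

/-- An accepted codeword of user 1 is within `t` of `x`, so the accepted codeword of user 2 is
within `2t` of the true one and hence equal in index. If no pair is accepted, no codeword of user 1
is compatible: it would be near `x` and form a plausible pair with `b`. So user 1 is blamed. -/
lemma okOne_decode {x : Fin n → Fin 2} {b : B} (h : ∀ a, ¬ Confuses t x (f₁ a) (f₂ b))
    (h' : ∀ b', b' ≠ b → ¬ Near (2 * t) (f₂ b') (f₂ b)) :
    (decode f₁ f₂ t (addOut x (f₂ b))).OkOne b := by
  unfold decode
  split_ifs with h1 h2
  · obtain ⟨k1, -, k3⟩ := h1.choose_spec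
    refine Or.inr ⟨h1.choose.1, ?_⟩
    congr 1
    by_contra hb
    refine h' _ hb ?_
    have := hammingDist_le_of_addOut (k1.hammingDist_le (h _)) k3
    rwa [← two_mul] at this
  · obtain ⟨a, ha⟩ := h2
    refine absurd ⟨(a, b), ha, ⟨x, addOut_comm _ _⟩, ?_⟩ h1
    rw [hammingDist_addOut_right]
    exact ha.hammingDist_le (h a)
  · exact Or.inl rfl

/-- A wrong accepted codeword of user 1 would be within `t` of `y`, putting the accepted codeword of
user 2 within `2t` of the codeword of `a`. If no pair is accepted, user 2 is blamed because the
codeword of `a` is itself compatible. -/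
lemma okTwo_decode {y : Fin n → Fin 2} {a : A}
    (h : ∀ a', a' ≠ a → ¬ Confuses t y (f₁ a') (f₁ a))
    (h' : ∀ b, ¬ Near (2 * t) (f₂ b) (f₁ a)) :
    (decode f₁ f₂ t (addOut (f₁ a) y)).OkTwo a := by
  unfold decode
  split_ifs with h1 h2
  · obtain ⟨k1, -, k3⟩ := h1.choose_spec
    refine Or.inr ⟨h1.choose.2, ?_⟩
    congr 1
    by_contra ha
    refine h' h1.choose.2 ?_
    have k1' : Compat (f₁ h1.choose.1) (addOut y (f₁ a)) := by
      simpa only [addOut_comm y] using k1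
    have k3' : hammingDist (addOut (f₁ h1.choose.1) (f₂ h1.choose.2)) (addOut y (f₁ a)) ≤ t := by
      simpa only [addOut_comm y] using k3
    have := hammingDist_le_of_addOut (k1'.hammingDist_le (h _ ha)) k3'
    rwa [← two_mul] at this
  · exact Or.inl rfl
  · exact absurd ⟨a, y, rfl⟩ h2

/-- The true pair is plausible, so nobody is blamed, and the two acceptability conditions fix the
two entries. Honest errors are thus controlled by the adversarial ones. -/
lemma decode_eq_messages {a : A} {b : B}
    (h₁ : (decode f₁ f₂ t (addOut (f₁ a) (f₂ b))).OkOne b)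
    (h₂ : (decode f₁ f₂ t (addOut (f₁ a) (f₂ b))).OkTwo a) :
    decode f₁ f₂ t (addOut (f₁ a) (f₂ b)) = .messages a b := by
  have h : ∃ p, Plausible f₁ f₂ t p (addOut (f₁ a) (f₂ b)) :=
    ⟨(a, b), ⟨_, rfl⟩, ⟨_, addOut_comm _ _⟩, by simp⟩
  unfold decode at h₁ h₂ ⊢
  rw [dif_pos h] at h₁ h₂ ⊢
  rcases h₁ with h₁ | ⟨a', h₁⟩
  · cases h₁
  rcases h₂ with h₂ | ⟨b', h₂⟩
  · cases h₂
  rw [h₁] at h₂ ⊢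
  cases h₂
  rfl

end Decoder

/-- Index all codewords by `A ⊕ B`, with the summands as `J` and `K`. Each adversarial error is
covered by two bad sets of proportion below `1/q`; the honest error is at most the sum of the two
adversarial ones. -/
lemma hasCode_of_codebooks {A B : Type} [Fintype A] [Fintype B] {n k t q : ℕ} (hq : 0 < q)
    (hlow : ∀ x : Fin n → Fin 2,
      (Finset.univ.filter fun v => (agreeSet x v).card < k).card * 2 ^ (8 * q + 1) ≤ 2 ^ n)
    (hA : Fintype.card A * 2 ^ t ≤ 2 ^ k) (ht : (n + 5) * 2 ^ (8 * q + 1) ≤ 2 ^ t)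
    (hB : Fintype.card B * (n + 1) ^ (2 * t) * 2 ^ (8 * q) ≤ 2 ^ n)
    (hA' : n + 3 ≤ Fintype.card A) (hB' : n + 3 ≤ Fintype.card B) :
    HasCode A B (Fin n) (4 / q) := by
  classical
  set J : Finset (A ⊕ B) := Finset.univ.map .inl with hJ
  set K : Finset (A ⊕ B) := Finset.univ.map .inr with hK
  have hJc : J.card = Fintype.card A := by simp [hJ]
  have hKc : K.card = Fintype.card B := by simp [hK]
  obtain ⟨F, h1, h2, h3, h4⟩ := exists_codebooks J K hlow (by rwa [hJc]) ht (by rwa [hKc])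
    (by rwa [hJc]) (by rwa [hKc])
  rw [hJc] at h2 h4
  rw [hKc] at h1 h3
  set f₁ : A → Fin n → Fin 2 := fun a => F (.inl a) with hf₁
  set f₂ : B → Fin n → Fin 2 := fun b => F (.inr b) with hf₂
  have hq' : (0 : ℝ) < q := by exact_mod_cast hq
  have cast : ∀ {a b c N : ℕ}, a ≤ b + c → q * b < N → q * c < N → (a : ℝ) ≤ 2 / q * N := by
    intro a b c N habc hb hc
    rw [div_mul_eq_mul_div, le_div_iff₀ hq']
    have : a * q ≤ 2 * N := by nlinarith
    exact_mod_cast this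
  have hone : ∀ x, ((Finset.univ.filter fun b =>
      ¬ (decode f₁ f₂ t (addOut x (f₂ b))).OkOne b).card : ℝ) ≤ 2 / q * Fintype.card B := by
    intro x
    refine cast ?_ (h1 x) h3
    refine (Finset.card_le_card_of_injOn Sum.inr ?_ Sum.inr_injective.injOn).trans
      (Finset.card_union_le _ _)
    intro b hb
    simp only [Finset.coe_filter, Finset.mem_univ, true_and, Set.mem_ofPred_eq] at hb
    by_contra hcon
    simp only [Finset.coe_union, Set.mem_union, Finset.mem_coe, badSet, Finset.mem_filter, hJ, hK,
      Finset.mem_map, Finset.mem_univ, true_and, Function.Embedding.inl_apply,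
      Function.Embedding.inr_apply, exists_exists_eq_and, not_or, Sum.inr.injEq, exists_eq,
      not_exists, not_and, ne_eq, reduceCtorEq, not_false_eq_true] at hcon
    exact hb (okOne_decode hcon.1 hcon.2)
  have htwo : ∀ y, ((Finset.univ.filter fun a =>
      ¬ (decode f₁ f₂ t (addOut (f₁ a) y)).OkTwo a).card : ℝ) ≤ 2 / q * Fintype.card A := by
    intro y
    refine cast ?_ (h2 y) h4
    refine (Finset.card_le_card_of_injOn Sum.inl ?_ Sum.inl_injective.injOn).trans
      (Finset.card_union_le _ _)
    intro a ha
    simp only [Finset.coe_filter, Finset.mem_univ, true_and, Set.mem_ofPred_eq] at ha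
    by_contra hcon
    simp only [Finset.coe_union, Set.mem_union, Finset.mem_coe, badSet, Finset.mem_filter, hJ, hK,
      Finset.mem_map, Finset.mem_univ, true_and, Function.Embedding.inl_apply,
      Function.Embedding.inr_apply, exists_exists_eq_and, not_or, Sum.inl.injEq, exists_eq,
      not_exists, not_and, ne_eq, reduceCtorEq, not_false_eq_true] at hcon
    exact ha (okTwo_decode hcon.1 hcon.2)
  have h24 : (2 : ℝ) / q ≤ 4 / q := by gcongr; norm_num
  refine ⟨f₁, f₂, decode f₁ f₂ t, ?_, fun x => (hone x).trans (by gcongr), fun y =>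
    (htwo y).trans (by gcongr)⟩
  have hsub : (Finset.univ.filter fun p : A × B =>
      decode f₁ f₂ t (addOut (f₁ p.1) (f₂ p.2)) ≠ .messages p.1 p.2).card ≤
      ∑ a, (Finset.univ.filter fun b =>
        ¬ (decode f₁ f₂ t (addOut (f₁ a) (f₂ b))).OkOne b).card +
      ∑ b, (Finset.univ.filter fun a =>
        ¬ (decode f₁ f₂ t (addOut (f₁ a) (f₂ b))).OkTwo a).card := by
    simp only [Finset.card_filter, Fintype.sum_prod_type]
    rw [Finset.sum_comm (s := (Finset.univ : Finset B)), ← Finset.sum_add_distrib]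
    refine Finset.sum_le_sum fun a _ => ?_
    rw [← Finset.sum_add_distrib]
    refine Finset.sum_le_sum fun b _ => ?_
    by_cases k1 : (decode f₁ f₂ t (addOut (f₁ a) (f₂ b))).OkOne b
    · by_cases k2 : (decode f₁ f₂ t (addOut (f₁ a) (f₂ b))).OkTwo a
      · simp [decode_eq_messages k1 k2]
      · simp only [k2, not_false_eq_true, if_true]
        split_ifs <;> simp
    · simp only [k1, not_false_eq_true, if_true]
      split_ifs <;> simp
  calc _ ≤ ((∑ a, (Finset.univ.filter fun b =>
        ¬ (decode f₁ f₂ t (addOut (f₁ a) (f₂ b))).OkOne b).card +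
      ∑ b, (Finset.univ.filter fun a =>
        ¬ (decode f₁ f₂ t (addOut (f₁ a) (f₂ b))).OkTwo a).card : ℕ) : ℝ) := by exact_mod_cast hsub
    _ ≤ ∑ _a : A, 2 / q * (Fintype.card B : ℝ) + ∑ _b : B, 2 / q * (Fintype.card A : ℝ) := by
        push_cast
        exact add_le_add (Finset.sum_le_sum fun a _ => hone _)
          (Finset.sum_le_sum fun b _ => htwo _)
    _ = _ := by simp; ring

/-! ### Time sharing -/

section TimeSharing

variable {A B A₁ B₁ A₂ B₂ : Type}

open Classical in
/-- The joint verdict of the decoders of two blocks, for messages embedded into pairs of messages.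
A pair of messages outside the range of the embedding reveals the user who sent it. -/
noncomputable def Outcome.combine (eA : A ↪ A₁ × A₂) (eB : B ↪ B₁ × B₂) :
    Outcome A₁ B₁ → Outcome A₂ B₂ → Outcome A B
  | .messages a₁ b₁, .messages a₂ b₂ =>
    if hA : ∃ a, eA a = (a₁, a₂) then
      if hB : ∃ b, eB b = (b₁, b₂) then .messages hA.choose hB.choose else .blameTwo
    else .blameOne
  | .messages _ _, .blameOne => .blameOne
  | .messages _ _, .blameTwo => .blameTwo
  | .blameOne, _ => .blameOne
  | .blameTwo, _ => .blameTwo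

variable {eA : A ↪ A₁ × A₂} {eB : B ↪ B₁ × B₂}

lemma Outcome.combine_messages (a : A) (b : B) :
    combine eA eB (.messages (eA a).1 (eB b).1) (.messages (eA a).2 (eB b).2) = .messages a b := by
  have hA : ∃ a', eA a' = ((eA a).1, (eA a).2) := ⟨a, rfl⟩
  have hB : ∃ b', eB b' = ((eB b).1, (eB b).2) := ⟨b, rfl⟩
  rw [combine, dif_pos hA, dif_pos hB, eA.injective hA.choose_spec, eB.injective hB.choose_spec]

/-- An honest user 2 stays inside the range of its embedding, so a pair of messages outside the
range can only blame user 1. -/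
lemma Outcome.okOne_combine {o₁ : Outcome A₁ B₁} {o₂ : Outcome A₂ B₂} {b : B}
    (h₁ : o₁.OkOne (eB b).1) (h₂ : o₂.OkOne (eB b).2) : (combine eA eB o₁ o₂).OkOne b := by
  rcases h₁ with rfl | ⟨a₁, rfl⟩
  · exact Or.inl rfl
  rcases h₂ with rfl | ⟨a₂, rfl⟩
  · exact Or.inl rfl
  by_cases hA : ∃ a, eA a = (a₁, a₂)
  · obtain ⟨a, ha⟩ := hA
    obtain ⟨rfl, rfl⟩ := Prod.mk.injEq .. ▸ ha.symm
    exact Or.inr ⟨a, combine_messages a b⟩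
  · rw [combine, dif_neg hA]
    exact Or.inl rfl

lemma Outcome.okTwo_combine {o₁ : Outcome A₁ B₁} {o₂ : Outcome A₂ B₂} {a : A}
    (h₁ : o₁.OkTwo (eA a).1) (h₂ : o₂.OkTwo (eA a).2) : (combine eA eB o₁ o₂).OkTwo a := by
  rcases h₁ with rfl | ⟨b₁, rfl⟩
  · exact Or.inl rfl
  rcases h₂ with rfl | ⟨b₂, rfl⟩
  · exact Or.inl rfl
  by_cases hB : ∃ b, eB b = (b₁, b₂)
  · obtain ⟨b, hb⟩ := hB
    obtain ⟨rfl, rfl⟩ := Prod.mk.injEq .. ▸ hb.symm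
    exact Or.inr ⟨b, combine_messages a b⟩
  · have hA : ∃ a', eA a' = ((eA a).1, (eA a).2) := ⟨a, rfl⟩
    rw [combine, dif_pos hA, dif_neg hB]
    exact Or.inl rfl

/-- A union bound over the two blocks inside the product; `C` is the factor lost by shrinking the
product to `B`. -/
lemma card_le_of_embedding [Fintype B] [Fintype B₁] [Fintype B₂] (e : B ↪ B₁ × B₂) {S : Finset B}
    {S₁ : Finset B₁} {S₂ : Finset B₂} (h : ∀ b ∈ S, (e b).1 ∈ S₁ ∨ (e b).2 ∈ S₂) {ε : ℝ}
    (hε : 0 ≤ ε) (h₁ : (S₁.card : ℝ) ≤ ε * Fintype.card B₁)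
    (h₂ : (S₂.card : ℝ) ≤ ε * Fintype.card B₂) {C : ℕ}
    (hC : Fintype.card B₁ * Fintype.card B₂ ≤ C * Fintype.card B) :
    (S.card : ℝ) ≤ 2 * C * ε * Fintype.card B := by
  classical
  have hcard : S.card ≤ S₁.card * Fintype.card B₂ + Fintype.card B₁ * S₂.card := by
    refine (Finset.card_le_card_of_injOn (t := S₁ ×ˢ Finset.univ ∪ Finset.univ ×ˢ S₂) e ?_
      e.injective.injOn).trans ((Finset.card_union_le _ _).trans (le_of_eq ?_))
    · intro b hb
      simpa using h b hb
    · simp [Finset.card_product]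
  calc (S.card : ℝ) ≤ S₁.card * Fintype.card B₂ + Fintype.card B₁ * S₂.card := by
        exact_mod_cast hcard
    _ ≤ ε * Fintype.card B₁ * Fintype.card B₂ + Fintype.card B₁ * (ε * Fintype.card B₂) := by
        gcongr
    _ = 2 * ε * ((Fintype.card B₁ * Fintype.card B₂ : ℕ) : ℝ) := by push_cast; ring
    _ ≤ 2 * ε * ((C * Fintype.card B : ℕ) : ℝ) := by gcongr
    _ = _ := by push_cast; ring

/-- Codes for two blocks give a code for the union of the blocks; the message sets may be
shrunk by a factor of at most `2`. -/
lemma HasCode.timeShare [Fintype A] [Fintype B] [Fintype A₁] [Fintype B₁] [Fintype A₂]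
    [Fintype B₂] {ι₁ ι₂ ι : Type} {ε : ℝ} (hε : 0 ≤ ε) (h₁ : HasCode A₁ B₁ ι₁ ε)
    (h₂ : HasCode A₂ B₂ ι₂ ε) (e : ι₁ ⊕ ι₂ ≃ ι) (eA : A ↪ A₁ × A₂) (eB : B ↪ B₁ × B₂)
    (hA : Fintype.card A₁ * Fintype.card A₂ ≤ 2 * Fintype.card A)
    (hB : Fintype.card B₁ * Fintype.card B₂ ≤ 2 * Fintype.card B) :
    HasCode A B ι (8 * ε) := by
  classical
  obtain ⟨f₁, g₁, d₁, p₁, q₁, r₁⟩ := h₁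
  obtain ⟨f₂, g₂, d₂, p₂, q₂, r₂⟩ := h₂
  let f : A → ι → Fin 2 := fun a i => Sum.elim (f₁ (eA a).1) (f₂ (eA a).2) (e.symm i)
  let g : B → ι → Fin 2 := fun b i => Sum.elim (g₁ (eB b).1) (g₂ (eB b).2) (e.symm i)
  let left : ∀ {S : Type}, (ι → S) → ι₁ → S := fun x i => x (e (.inl i))
  let right : ∀ {S : Type}, (ι → S) → ι₂ → S := fun x i => x (e (.inr i))
  have hfl : ∀ a, left (f a) = f₁ (eA a).1 := fun a => by funext i; simp [left, f]
  have hfr : ∀ a, right (f a) = f₂ (eA a).2 := fun a => by funext i; simp [right, f]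
  have hgl : ∀ b, left (g b) = g₁ (eB b).1 := fun b => by funext i; simp [left, g]
  have hgr : ∀ b, right (g b) = g₂ (eB b).2 := fun b => by funext i; simp [right, g]
  have hl : ∀ x y : ι → Fin 2, left (addOut x y) = addOut (left x) (left y) := fun x y => rfl
  have hr : ∀ x y : ι → Fin 2, right (addOut x y) = addOut (right x) (right y) := fun x y => rfl
  refine ⟨f, g, fun z => (d₁ (left z)).combine eA eB (d₂ (right z)), ?_, fun x => ?_, fun y => ?_⟩
  · let eAB : A × B ↪ (A₁ × B₁) × (A₂ × B₂) :=
      ⟨fun p => (((eA p.1).1, (eB p.2).1), ((eA p.1).2, (eB p.2).2)), by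
        rintro ⟨a, b⟩ ⟨a', b'⟩ h
        simp only [Prod.mk.injEq] at h ⊢
        exact ⟨eA.injective (Prod.ext h.1.1 h.2.1), eB.injective (Prod.ext h.1.2 h.2.2)⟩⟩
    -- Both message sets shrink by a factor of at most 2, hence `C = 4` and the final `8ε`.
    have := card_le_of_embedding eAB (S := Finset.univ.filter fun p : A × B =>
      (d₁ (left (addOut (f p.1) (g p.2)))).combine eA eB (d₂ (right (addOut (f p.1) (g p.2)))) ≠
        .messages p.1 p.2) (fun p hp => ?_) hε
      (by rw [Fintype.card_prod]; exact_mod_cast p₁) (by rw [Fintype.card_prod]; exact_mod_cast p₂)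
      (C := 4) (by simp only [Fintype.card_prod]; nlinarith [Nat.mul_le_mul hA hB])
    · refine this.trans (le_of_eq ?_)
      rw [Fintype.card_prod]
      push_cast
      ring
    · simp only [Finset.mem_filter, Finset.mem_univ, true_and, hl, hr, hfl, hfr, hgl, hgr] at hp ⊢
      by_contra! hcon
      refine hp ?_
      have h1 : d₁ (addOut (f₁ (eA p.1).1) (g₁ (eB p.2).1)) =
        .messages (eA p.1).1 (eB p.2).1 := hcon.1
      have h2 : d₂ (addOut (f₂ (eA p.1).2) (g₂ (eB p.2).2)) =
        .messages (eA p.1).2 (eB p.2).2 := hcon.2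
      rw [h1, h2, Outcome.combine_messages]
  · have := card_le_of_embedding eB (S := Finset.univ.filter fun b =>
      ¬ ((d₁ (left (addOut x (g b)))).combine eA eB (d₂ (right (addOut x (g b))))).OkOne b)
      (fun b hb => ?_) hε (q₁ (left x)) (q₂ (right x)) hB
    · refine this.trans ?_
      push_cast
      gcongr
      linarith
    · simp only [Finset.mem_filter, Finset.mem_univ, true_and, hl, hr, hgl, hgr] at hb ⊢
      by_contra! hcon
      exact hb (Outcome.okOne_combine hcon.1 hcon.2)
  · have := card_le_of_embedding eA (S := Finset.univ.filter fun a =>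
      ¬ ((d₁ (left (addOut (f a) y))).combine eA eB (d₂ (right (addOut (f a) y)))).OkTwo a)
      (fun a ha => ?_) hε (r₁ (left y)) (r₂ (right y)) hA
    · refine this.trans ?_
      push_cast
      gcongr
      linarith
    · simp only [Finset.mem_filter, Finset.mem_univ, true_and, hl, hr, hfl, hfr] at ha ⊢
      by_contra! hcon
      exact ha (Outcome.okTwo_combine hcon.1 hcon.2)

end TimeSharing

/-! ### From counting codes to channel codes. -/

lemma sum_prob_erasureMAC {β : Type*} [Fintype β] {n : ℕ} (f g : β → Fin n → Fin 2)
    (E : β → Set (Fin n → Fin 3)) (P : β → Prop) [DecidablePred P]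
    (h : ∀ b, addOut (f b) (g b) ∈ E b ↔ P b) :
    ∑ b, erasureMAC.prob (f b) (g b) (E b) = (Finset.univ.filter P).card := by
  rw [Finset.card_filter]
  push_cast
  refine Finset.sum_congr rfl fun b _ => ?_
  rw [prob_erasureMAC]
  by_cases hb : P b
  · rw [if_pos ((h b).2 hb), if_pos hb]
  · rw [if_neg fun h' => hb ((h b).1 h'), if_neg hb]

/-- A code for the adder is an adversary identifying code for the binary erasure MAC. -/
lemma HasCode.exists_advIdCode {N₁ N₂ n : ℕ} (h₁ : 0 < N₁) (h₂ : 0 < N₂) {ε : ℝ}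
    (h : HasCode (Fin N₁) (Fin N₂) (Fin n) ε) :
    ∃ c : AdvIdCode (Fin 2) (Fin 2) (Fin 3) N₁ N₂ n, c.err erasureMAC ≤ ε := by
  classical
  obtain ⟨f₁, f₂, dec, p, q, r⟩ := h
  let toVerdict : Outcome (Fin N₁) (Fin N₂) → Verdict N₁ N₂
    | .messages a b => .messages a b
    | .blameOne => .blameOne
    | .blameTwo => .blameTwo
  have hN₁ : (0 : ℝ) < N₁ := by exact_mod_cast h₁
  have hN₂ : (0 : ℝ) < N₂ := by exact_mod_cast h₂
  have hmsg : ∀ o a b, toVerdict o ≠ .messages a b ↔ o ≠ .messages a b := by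
    intro o a b; cases o <;> simp [toVerdict]
  have hone : ∀ o b, (toVerdict o ≠ .blameOne ∧ ∀ a, toVerdict o ≠ .messages a b) ↔
      ¬ o.OkOne b := by
    intro o b; cases o <;> simp [toVerdict, Outcome.OkOne]
  have htwo : ∀ o a, (toVerdict o ≠ .blameTwo ∧ ∀ b, toVerdict o ≠ .messages a b) ↔
      ¬ o.OkTwo a := by
    intro o a; cases o <;> simp [toVerdict, Outcome.OkTwo]
  refine ⟨⟨f₁, f₂, fun z => toVerdict (dec z)⟩, max_le ?_ (max_le (ciSup_le fun x => ?_)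
    (ciSup_le fun y => ?_))⟩
  · rw [AdvIdCode.errHonest, one_div, inv_mul_le_iff₀ (by positivity), ← Fintype.sum_prod_type'
      (f := fun a b => erasureMAC.prob (f₁ a) (f₂ b)
        {z | toVerdict (dec z) ≠ Verdict.messages a b}),
      sum_prob_erasureMAC (β := Fin N₁ × Fin N₂) (fun p => f₁ p.1) (fun p => f₂ p.2) _ _
        fun p => hmsg _ p.1 p.2, mul_comm]
    simpa using p
  · rw [one_div, inv_mul_le_iff₀ (by positivity),
      sum_prob_erasureMAC (fun _ => x) f₂ _ _ fun b => hone _ b, mul_comm]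
    simpa using q x
  · rw [one_div, inv_mul_le_iff₀ (by positivity),
      sum_prob_erasureMAC f₁ (fun _ => y) _ _ fun a => htwo _ a, mul_comm]
    simpa using r y

/-! ### Asymptotics -/

lemma HasCode.mono {A B ι : Type} [Fintype A] [Fintype B] {ε ε' : ℝ} (h : HasCode A B ι ε)
    (hε : ε ≤ ε') : HasCode A B ι ε' := by
  obtain ⟨f₁, f₂, dec, h0, h1, h2⟩ := h
  exact ⟨f₁, f₂, dec, h0.trans (by gcongr), fun x => (h1 x).trans (by gcongr),
    fun y => (h2 y).trans (by gcongr)⟩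

lemma eventually_logb_sq_le (C : ℝ) {c : ℝ} (hc : 0 < c) :
    ∀ᶠ n : ℕ in atTop, C * (1 + Real.logb 2 (n + 5)) ^ 2 ≤ c * n := by
  have hlog : 0 < Real.log 2 := Real.log_pos (by norm_num)
  have htend : Tendsto (fun n : ℕ => 2 * ((n : ℝ) + 5)) atTop atTop :=
    (tendsto_atTop_add_const_right _ _ tendsto_natCast_atTop_atTop).const_mul_atTop two_pos
  set C' := |C| + 1 with hC'
  have hC'pos : 0 < C' := by positivity
  have h := (Real.isLittleO_pow_log_id_atTop (n := 2)).comp_tendsto htend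
  have h' := h.bound (show 0 < c * Real.log 2 ^ 2 / (12 * C') by positivity)
  filter_upwards [h', eventually_ge_atTop 1] with n hn hn1
  have hn1' : (1 : ℝ) ≤ n := by exact_mod_cast hn1
  simp only [Function.comp_apply, id, Real.norm_eq_abs] at hn
  rw [abs_of_nonneg (by positivity), abs_of_nonneg (by positivity)] at hn
  have hL : 1 + Real.logb 2 (n + 5) = Real.log (2 * ((n : ℝ) + 5)) / Real.log 2 := by
    rw [Real.logb, Real.log_mul two_ne_zero (by positivity)]
    field_simp
  rw [hL, div_pow]
  have hsq : 0 ≤ Real.log (2 * ((n : ℝ) + 5)) ^ 2 / Real.log 2 ^ 2 := by positivity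
  calc C * (Real.log (2 * ((n : ℝ) + 5)) ^ 2 / Real.log 2 ^ 2)
      ≤ C' * (Real.log (2 * ((n : ℝ) + 5)) ^ 2 / Real.log 2 ^ 2) :=
        mul_le_mul_of_nonneg_right ((le_abs_self C).trans (by linarith)) hsq
    _ ≤ C' * ((c * Real.log 2 ^ 2 / (12 * C') * (2 * ((n : ℝ) + 5))) / Real.log 2 ^ 2) := by
        gcongr
    _ = c * ((2 * ((n : ℝ) + 5)) / 12) := by field_simp
    _ ≤ c * n := by gcongr; linarith

/-- With `q` fixed and `t` of order `log n`, confusions limit user 1 to rate 1/2, the typical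
agreement with `x`, while the balls of radius `2t` cost user 2 only `O(log² n)` bits. The window of
three bits around each rate absorbs the rounding in time sharing. -/
lemma eventually_hasCode_corner {a₁ a₂ ε : ℝ} (h₁ : 0 < a₁) (h₁' : a₁ < 1 / 2) (h₂ : 0 < a₂)
    (h₂' : a₂ < 1) (hε : 0 < ε) :
    ∀ᶠ n : ℕ in atTop, ∀ N₁ N₂ : ℕ,
      (2 : ℝ) ^ (n * a₁ - 3) ≤ N₁ → (N₁ : ℝ) ≤ 2 ^ (n * a₁ + 3) →
      (2 : ℝ) ^ (n * a₂ - 3) ≤ N₂ → (N₂ : ℝ) ≤ 2 ^ (n * a₂ + 3) →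
      HasCode (Fin N₁) (Fin N₂) (Fin n) ε := by
  have hlog : 0 < Real.log 2 := Real.log_pos (by norm_num)
  obtain ⟨q, hq⟩ := exists_nat_gt (4 / ε)
  have hq0 : (0 : ℝ) < q := lt_trans (by positivity) hq
  have hqε : 4 / (q : ℝ) ≤ ε := by
    rw [div_le_iff₀ hq0]; rw [div_lt_iff₀ hε] at hq; linarith
  -- This makes `1/2 - δ = a₁ + δ`, leaving `δn` bits of room in the bound on `|A|`.
  set δ := (1 / 2 - a₁) / 2 with hδ
  have hδ0 : 0 < δ := by rw [hδ]; linarith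
  -- The constant `24q + 12` dominates both `hbase` and `hquad` below.
  have ev := fun c (hc : 0 < c) => eventually_logb_sq_le (24 * q + 12) hc
  filter_upwards [ev δ hδ0, ev (2 * δ ^ 2) (by positivity), ev a₁ h₁, ev a₂ h₂,
    ev (1 - a₂) (by linarith)] with n e1 e2 e3 e4 e5 N₁ N₂ l1 u1 l2 u2
  set L := Real.logb 2 (n + 5) with hL
  have hL0 : 0 ≤ L := Real.logb_nonneg (by norm_num) (by linarith [(Nat.cast_nonneg n : (0:ℝ) ≤ n)])
  have h2L : (2 : ℝ) ^ L = n + 5 := Real.rpow_logb two_pos (by norm_num) (by positivity)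
  have hLL : 1 + L ≤ (1 + L) ^ 2 := by nlinarith
  have hbase : 24 * (q : ℝ) + 12 + 12 * L ≤ (24 * q + 12) * (1 + L) ^ 2 := by
    have : (24 * (q : ℝ) + 12) * (1 + L) ≤ (24 * q + 12) * (1 + L) ^ 2 :=
      mul_le_mul_of_nonneg_left hLL (by positivity)
    have hqL := mul_nonneg hq0.le hL0
    linarith
  have hquad : 3 + (1 + L) * (2 * ((8 * q + 2) * (1 + L))) + 8 * q ≤
      (24 * q + 12) * (1 + L) ^ 2 := by
    have h1 : 1 ≤ (1 + L) ^ 2 := by linarith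
    have h2 : (8 * (q : ℝ) + 8) * 1 ≤ (8 * q + 8) * (1 + L) ^ 2 :=
      mul_le_mul_of_nonneg_left h1 (by positivity)
    linarith
  replace hquad := hquad.trans e5
  replace e1 := hbase.trans e1
  replace e2 := hbase.trans e2
  replace e3 := hbase.trans e3
  replace e4 := hbase.trans e4
  clear e5 hbase hLL
  set t := 8 * q + 1 + Nat.clog 2 (n + 5) with ht
  have htL : (t : ℝ) ≤ 8 * q + 2 + L := by
    have hlt : 2 ^ (Nat.clog 2 (n + 5)).pred < n + 5 :=
      Nat.pow_pred_clog_lt_self (by norm_num) (by omega)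
    have hlt' : (2 : ℝ) ^ ((Nat.clog 2 (n + 5)).pred : ℝ) ≤ 2 ^ L := by
      rw [h2L, Real.rpow_natCast]; exact_mod_cast hlt.le
    have hle := (Real.rpow_le_rpow_left_iff one_lt_two).1 hlt'
    have hpred : Nat.clog 2 (n + 5) ≤ (Nat.clog 2 (n + 5)).pred + 1 := by
      rw [Nat.pred_eq_sub_one]; omega
    have hpred' : (Nat.clog 2 (n + 5) : ℝ) ≤ (Nat.clog 2 (n + 5)).pred + 1 := by
      exact_mod_cast hpred
    rw [ht]; push_cast; linarith
  set k := ⌈(n : ℝ) * (1 / 2 - δ)⌉₊ with hk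
  have hkge : (n : ℝ) * (1 / 2 - δ) ≤ k := Nat.le_ceil _
  refine HasCode.mono (hasCode_of_codebooks (k := k) (t := t) (by exact_mod_cast hq0) ?_ ?_ ?_ ?_
    ?_ ?_) hqε
  · intro x
    have hsub : (Finset.univ.filter fun v => (agreeSet x v).card < k) ⊆
        Finset.univ.filter fun v => ((agreeSet x v).card : ℝ) ≤ n * (1 / 2 - δ) :=
      Finset.monotone_filter_right _ fun v _ hv => (Nat.lt_ceil.1 hv).le
    have h3 : ((Finset.univ.filter fun v => (agreeSet x v).card < k).card : ℝ) ≤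
        2 ^ n * Real.exp (-(2 * δ ^ 2 * n)) :=
      le_trans (by exact_mod_cast Finset.card_le_card hsub) (card_agreeSet_small_le x hδ0.le)
    have h4 : Real.exp (-(2 * δ ^ 2 * n)) * 2 ^ (8 * q + 1) ≤ 1 := by
      rw [← Real.exp_log (show (0 : ℝ) < 2 ^ (8 * q + 1) by positivity), ← Real.exp_add,
        Real.exp_le_one_iff, Real.log_pow]
      push_cast
      have : (8 * (q : ℝ) + 1) * Real.log 2 ≤ (8 * q + 1) * 1 :=
        mul_le_mul_of_nonneg_left (by linarith [Real.log_two_lt_d9]) (by positivity)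
      linarith
    have h5 : ((Finset.univ.filter fun v => (agreeSet x v).card < k).card : ℝ) *
        2 ^ (8 * q + 1) ≤ 2 ^ n := by
      calc _ ≤ 2 ^ n * Real.exp (-(2 * δ ^ 2 * n)) * 2 ^ (8 * q + 1) := by gcongr
        _ = 2 ^ n * (Real.exp (-(2 * δ ^ 2 * n)) * 2 ^ (8 * q + 1)) := by ring
        _ ≤ 2 ^ n * 1 := by gcongr
        _ = _ := mul_one _
    exact_mod_cast h5
  · rw [Fintype.card_fin]
    have : (N₁ : ℝ) * 2 ^ t ≤ 2 ^ k := by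
      calc (N₁ : ℝ) * 2 ^ t ≤ 2 ^ (n * a₁ + 3) * 2 ^ (t : ℝ) := by
            rw [Real.rpow_natCast]; gcongr
        _ = 2 ^ (n * a₁ + 3 + t) := (Real.rpow_add two_pos _ _).symm
        _ ≤ 2 ^ (k : ℝ) := by
            refine Real.rpow_le_rpow_of_exponent_le one_le_two ?_
            have : (n : ℝ) * (1 / 2 - δ) = n * a₁ + δ * n := by rw [hδ]; ring
            linarith
        _ = _ := Real.rpow_natCast _ _
    exact_mod_cast this
  · rw [ht, pow_add 2 (8 * q + 1), mul_comm]
    exact Nat.mul_le_mul_left _ (Nat.le_pow_clog one_lt_two _)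
  · rw [Fintype.card_fin]
    have hn1 : ((n : ℝ) + 1) ≤ 2 ^ L := by rw [h2L]; linarith
    have : (N₂ : ℝ) * (n + 1) ^ (2 * t) * 2 ^ (8 * q) ≤ 2 ^ n := by
      calc (N₂ : ℝ) * (n + 1) ^ (2 * t) * 2 ^ (8 * q)
          ≤ 2 ^ (n * a₂ + 3) * ((2 : ℝ) ^ L) ^ (2 * t) * 2 ^ (8 * q) := by gcongr
        _ = 2 ^ (n * a₂ + 3 + L * (2 * t : ℕ) + (8 * q : ℕ)) := by
            rw [Real.rpow_add two_pos (n * a₂ + 3 + L * (2 * t : ℕ)),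
              Real.rpow_add two_pos (n * a₂ + 3) (L * (2 * t : ℕ)), Real.rpow_natCast 2 (8 * q),
              Real.rpow_mul two_pos.le, Real.rpow_natCast _ (2 * t)]
        _ ≤ 2 ^ (n : ℝ) := by
            refine Real.rpow_le_rpow_of_exponent_le one_le_two ?_
            push_cast
            have h6 : L * (2 * t) ≤ (1 + L) * (2 * ((8 * q + 2) * (1 + L))) := by
              have hqL := mul_nonneg hq0.le hL0
              have : (t : ℝ) ≤ (8 * q + 2) * (1 + L) := by linarith
              gcongr
              linarith
            linarith
        _ = _ := Real.rpow_natCast _ _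
    exact_mod_cast this
  · rw [Fintype.card_fin]
    have : (n : ℝ) + 5 ≤ N₁ := by
      rw [← h2L]
      refine le_trans (Real.rpow_le_rpow_of_exponent_le one_le_two ?_) l1
      linarith
    have : n + 5 ≤ N₁ := by exact_mod_cast this
    omega
  · rw [Fintype.card_fin]
    have : (n : ℝ) + 5 ≤ N₂ := by
      rw [← h2L]
      refine le_trans (Real.rpow_le_rpow_of_exponent_le one_le_two ?_) l2
      linarith
    have : n + 5 ≤ N₂ := by exact_mod_cast this
    omega

lemma numMsg_bounds {a : ℝ} (ha : 0 ≤ a) (n : ℕ) :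
    (2 : ℝ) ^ (n * a - 3) ≤ numMsg a n ∧ (numMsg a n : ℝ) ≤ 2 ^ (n * a + 3) := by
  constructor
  · have h := two_rpow_le_two_mul_numMsg ha n
    have h8 : (2 : ℝ) ^ (n * a - 3) = 2 ^ (n * a) / 8 := by
      rw [Real.rpow_sub two_pos]; norm_num
    rw [h8]
    linarith [(Nat.cast_nonneg _ : (0 : ℝ) ≤ numMsg a n)]
  · exact (numMsg_le a n).trans (Real.rpow_le_rpow_of_exponent_le one_le_two (by linarith))

/-- A message set of rate `l * a + (1 - l) * b` for blocklength `n` embeds into the product of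
message sets of rates `a` and `b` for blocks of lengths about `l * n` and `(1 - l) * n`. -/
lemma exists_splitting {l a b : ℝ} (hl0 : 0 ≤ l) (ha0 : 0 ≤ a) (ha1 : a ≤ 1)
    (hb0 : 0 ≤ b) (hb1 : b ≤ 1) {n n₁ n₂ : ℕ} (hn : n₁ + n₂ = n) (h₁ : (n₁ : ℝ) ≤ l * n)
    (h₁' : l * n ≤ n₁ + 1) (hl1 : l ≤ 1) :
    ∃ N₁ N₂ : ℕ,
      ((2 : ℝ) ^ (n₁ * a - 3) ≤ N₁ ∧ (N₁ : ℝ) ≤ 2 ^ (n₁ * a + 3)) ∧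
      ((2 : ℝ) ^ (n₂ * b - 3) ≤ N₂ ∧ (N₂ : ℝ) ≤ 2 ^ (n₂ * b + 3)) ∧
      numMsg (l * a + (1 - l) * b) n ≤ N₁ * N₂ ∧
      N₁ * N₂ ≤ 2 * numMsg (l * a + (1 - l) * b) n := by
  set R := l * a + (1 - l) * b with hR
  have hR0 : 0 ≤ R := add_nonneg (mul_nonneg hl0 ha0) (mul_nonneg (by linarith) hb0)
  set N := numMsg R n with hN
  set M := numMsg a n₁ with hM
  have hnn : (n : ℝ) = n₁ + n₂ := by rw [← hn]; push_cast; ring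
  have hexp : n * R - n₁ * a = (l * n - n₁) * a + (n₂ - (l * n - n₁)) * b := by
    rw [hR, hnn]; ring
  have hd0 : 0 ≤ l * n - n₁ := by linarith
  have hd1 : l * n - n₁ ≤ 1 := by linarith
  have hup : n * R - n₁ * a ≤ n₂ * b + 1 := by
    rw [hexp]
    have := mul_le_mul hd1 ha1 ha0 zero_le_one
    have := mul_nonneg hd0 hb0
    linarith
  have hlo : n₂ * b - 1 ≤ n * R - n₁ * a := by
    rw [hexp]
    have := mul_le_mul hd1 hb1 hb0 zero_le_one
    have := mul_nonneg hd0 ha0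
    linarith
  have hlo' : n₁ * a ≤ n * R := by
    have hge : 0 ≤ n₂ - (l * n - n₁) := by
      have : 0 ≤ (1 - l) * n := mul_nonneg (by linarith) (Nat.cast_nonneg n)
      linarith
    have := mul_nonneg hd0 ha0
    have := mul_nonneg hge hb0
    linarith
  have hMpos : 0 < M := numMsg_pos ha0 n₁
  have hMpos' : (0 : ℝ) < M := by exact_mod_cast hMpos
  have hMN : M ≤ N := Nat.floor_le_floor (Real.rpow_le_rpow_of_exponent_le one_le_two hlo')
  have hN2 := two_rpow_le_two_mul_numMsg hR0 n
  have hM2 := two_rpow_le_two_mul_numMsg ha0 n₁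
  have hNu := numMsg_le R n
  have hMu := numMsg_le a n₁
  rw [← hN] at hN2 hNu
  rw [← hM] at hM2 hMu
  -- Since `M ≤ N`, rounding the quotient up gives `N < M * D ≤ 2N`.
  set D := N / M + 1 with hD
  have hdiv1 : M * (N / M) ≤ N := Nat.mul_div_le N M
  have hdiv2 : N < M * D := by rw [hD]; exact Nat.lt_mul_div_succ N hMpos
  have hMD : M * D ≤ 2 * N := by rw [hD, mul_add, mul_one]; linarith
  have hMDr : (M : ℝ) * D ≤ 2 * N := by exact_mod_cast hMD
  have hdiv2r : (N : ℝ) ≤ M * D := by exact_mod_cast hdiv2.le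
  have hsplit : (2 : ℝ) ^ (n * R) = 2 ^ (n₁ * a) * 2 ^ (n * R - n₁ * a) := by
    rw [← Real.rpow_add two_pos]; congr 1; ring
  have hpos : (0 : ℝ) < 2 ^ (n₁ * a) := by positivity
  refine ⟨M, D, numMsg_bounds ha0 n₁, ⟨?_, ?_⟩, hdiv2.le, hMD⟩
  · have h3 : (2 : ℝ) ^ (n₁ * a) * 2 ^ (n₂ * b - 3) ≤ 2 ^ (n₁ * a) * D := by
      calc (2 : ℝ) ^ (n₁ * a) * 2 ^ (n₂ * b - 3)
          ≤ 2 ^ (n₁ * a) * 2 ^ (n * R - n₁ * a - 1) := by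
            refine mul_le_mul_of_nonneg_left ?_ hpos.le
            exact Real.rpow_le_rpow_of_exponent_le one_le_two (by linarith)
        _ = 2 ^ (n * R) / 2 := by rw [Real.rpow_sub_one two_ne_zero, hsplit]; ring
        _ ≤ N := by linarith
        _ ≤ M * D := hdiv2r
        _ ≤ _ := mul_le_mul_of_nonneg_right hMu (Nat.cast_nonneg _)
    exact le_of_mul_le_mul_left h3 hpos
  · have h3 : (2 : ℝ) ^ (n₁ * a) * D ≤ 2 ^ (n₁ * a) * 2 ^ (n₂ * b + 3) := by
      calc (2 : ℝ) ^ (n₁ * a) * D ≤ 2 * M * D :=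
            mul_le_mul_of_nonneg_right hM2 (Nat.cast_nonneg _)
        _ ≤ 4 * 2 ^ (n * R) := by linarith
        _ = 2 ^ (n₁ * a) * 2 ^ (n * R - n₁ * a + 2) := by
            rw [Real.rpow_add two_pos, hsplit]; norm_num; ring
        _ ≤ _ := by
            refine mul_le_mul_of_nonneg_left ?_ hpos.le
            exact Real.rpow_le_rpow_of_exponent_le one_le_two (by linarith)
    exact le_of_mul_le_mul_left h3 hpos

/-- Share time between the corner codes in proportion `l`, each user's rate in its better block
being twice that in the other. The corner conditions become `2R₂ - 1 < l < 2 - 2R₁`, solvable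
exactly because `R₁ + R₂ < 3/2`. -/
lemma eventually_hasCode {R₁ R₂ ε : ℝ} (h₁ : 0 < R₁) (h₁' : R₁ < 1) (h₂ : 0 < R₂) (h₂' : R₂ < 1)
    (hsum : R₁ + R₂ < 3 / 2) (hε : 0 < ε) :
    ∀ᶠ n : ℕ in atTop, HasCode (Fin (numMsg R₁ n)) (Fin (numMsg R₂ n)) (Fin n) ε := by
  obtain ⟨l, hl1, hl2⟩ : ∃ l, max 0 (2 * R₂ - 1) < l ∧ l < min 1 (2 - 2 * R₁) :=
    exists_between (by
      rw [max_lt_iff, lt_min_iff, lt_min_iff]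
      refine ⟨⟨?_, ?_⟩, ?_, ?_⟩ <;> linarith)
  rw [max_lt_iff] at hl1
  rw [lt_min_iff] at hl2
  obtain ⟨hl0, hlR₂⟩ := hl1
  obtain ⟨hl1, hlR₁⟩ := hl2
  have d1 : 0 < 2 - l := by linarith
  have d2 : 0 < 1 + l := by linarith
  set a₁ := R₁ / (2 - l) with ha₁
  set b₁ := 2 * (R₁ / (2 - l)) with hb₁
  set a₂ := 2 * (R₂ / (1 + l)) with ha₂
  set b₂ := R₂ / (1 + l) with hb₂
  have hR₁ : l * a₁ + (1 - l) * b₁ = R₁ := by rw [ha₁, hb₁]; field_simp; ring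
  have hR₂ : l * a₂ + (1 - l) * b₂ = R₂ := by rw [ha₂, hb₂]; field_simp; ring
  have ha₁0 : 0 < a₁ := by positivity
  have hb₂0 : 0 < b₂ := by positivity
  have ha₁1 : a₁ < 1 / 2 := by rw [ha₁, div_lt_iff₀ d1]; linarith
  have hb₂1 : b₂ < 1 / 2 := by rw [hb₂, div_lt_iff₀ d2]; linarith
  have hb₁0 : 0 < b₁ := by positivity
  have ha₂0 : 0 < a₂ := by positivity
  have hb₁1 : b₁ < 1 := by rw [hb₁, ← ha₁]; linarith
  have ha₂1 : a₂ < 1 := by rw [ha₂]; linarith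
  have hε8 : 0 < ε / 8 := by positivity
  have htend₁ : Tendsto (fun n : ℕ => ⌊l * n⌋₊) atTop atTop :=
    tendsto_nat_floor_atTop.comp (tendsto_natCast_atTop_atTop.const_mul_atTop hl0)
  have hfloor : ∀ n : ℕ, ((⌊l * n⌋₊ : ℕ) : ℝ) ≤ l * n := fun n => Nat.floor_le (by positivity)
  have hle : ∀ n : ℕ, ⌊l * n⌋₊ ≤ n := fun n => by
    have : ((⌊l * n⌋₊ : ℕ) : ℝ) ≤ n :=
      (hfloor n).trans (mul_le_of_le_one_left (Nat.cast_nonneg n) hl1.le)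
    exact_mod_cast this
  have htend₂ : Tendsto (fun n : ℕ => n - ⌊l * n⌋₊) atTop atTop := by
    refine tendsto_atTop_mono (fun n => ?_) (tendsto_nat_floor_atTop.comp
      (tendsto_natCast_atTop_atTop.const_mul_atTop (by linarith : 0 < 1 - l)))
    simp only [Function.comp_apply]
    have h3 : ((⌊(1 - l) * n⌋₊ : ℕ) : ℝ) ≤ (1 - l) * n :=
      Nat.floor_le (mul_nonneg (by linarith) (Nat.cast_nonneg n))
    have h4 : ((⌊(1 - l) * n⌋₊ + ⌊l * n⌋₊ : ℕ) : ℝ) ≤ n := by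
      push_cast; linarith [hfloor n]
    have h5 : ⌊(1 - l) * n⌋₊ + ⌊l * n⌋₊ ≤ n := by exact_mod_cast h4
    omega
  filter_upwards [htend₁.eventually (eventually_hasCode_corner ha₁0 ha₁1 ha₂0 ha₂1 hε8),
    htend₂.eventually (eventually_hasCode_corner hb₂0 hb₂1 hb₁0 hb₁1 hε8)] with n e1 e2
  have hn : ⌊l * n⌋₊ + (n - ⌊l * n⌋₊) = n := Nat.add_sub_cancel' (hle n)
  have hlt : l * n ≤ ((⌊l * n⌋₊ : ℕ) : ℝ) + 1 := (Nat.lt_floor_add_one _).le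
  obtain ⟨N₁, N₁', u1, u2, u3, u4⟩ := exists_splitting hl0.le ha₁0.le (by linarith) hb₁0.le hb₁1.le
    hn (hfloor n) hlt hl1.le
  obtain ⟨N₂, N₂', v1, v2, v3, v4⟩ := exists_splitting hl0.le ha₂0.le ha₂1.le hb₂0.le (by linarith)
    hn (hfloor n) hlt hl1.le
  rw [hR₁] at u3 u4
  rw [hR₂] at v3 v4
  have c1 := e1 N₁ N₂ u1.1 u1.2 v1.1 v1.2
  have c2 := (e2 N₂' N₁' v2.1 v2.2 u2.1 u2.2).swap
  obtain ⟨eA⟩ : Nonempty (Fin (numMsg R₁ n) ↪ Fin N₁ × Fin N₁') :=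
    Function.Embedding.nonempty_of_card_le (by simpa using u3)
  obtain ⟨eB⟩ : Nonempty (Fin (numMsg R₂ n) ↪ Fin N₂ × Fin N₂') :=
    Function.Embedding.nonempty_of_card_le (by simpa using v3)
  have := HasCode.timeShare hε8.le c1 c2 (finSumFinEquiv.trans (finCongr hn)) eA eB
    (by simpa using u4) (by simpa using v4)
  exact this.mono (by linarith)

/-! ### The capacity regions -/

lemma AdvIdCode.errHonest_nonneg {X Y Z : Type} [Fintype Z] {N₁ N₂ n : ℕ}
    (c : AdvIdCode X Y Z N₁ N₂ n) (W : MAC X Y Z) : 0 ≤ c.errHonest W :=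
  mul_nonneg (by positivity) <| Finset.sum_nonneg fun _ _ => Finset.sum_nonneg fun _ _ =>
    Finset.sum_nonneg fun _ _ => Set.indicator_nonneg
      (fun _ _ => Finset.prod_nonneg fun _ _ => W.nonneg _ _ _) _

theorem pentagon_subset_advIdCapacityRegion : pentagon ⊆ advIdCapacityRegion erasureMAC := by
  have hint : ∀ R₁ R₂ : ℝ, 0 < R₁ → R₁ < 1 → 0 < R₂ → R₂ < 1 → R₁ + R₂ < 3 / 2 →
      (R₁, R₂) ∈ {R : ℝ × ℝ | 0 ≤ R.1 ∧ 0 ≤ R.2 ∧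
        ∃ c : (n : ℕ) → AdvIdCode (Fin 2) (Fin 2) (Fin 3) (numMsg R.1 n) (numMsg R.2 n) n,
          Tendsto (fun n => (c n).err erasureMAC) atTop (𝓝 0)} := by
    intro R₁ R₂ h1 h2 h3 h4 h5
    refine ⟨h1.le, h3.le, ?_⟩
    simp only
    have hnonneg : ∀ (n : ℕ) (c : AdvIdCode (Fin 2) (Fin 2) (Fin 3) (numMsg R₁ n) (numMsg R₂ n) n),
        0 ≤ c.err erasureMAC := fun n c => (c.errHonest_nonneg _).trans (le_max_left _ _)
    have hbdd : ∀ n : ℕ, BddBelow (Set.range fun c : AdvIdCode (Fin 2) (Fin 2) (Fin 3)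
        (numMsg R₁ n) (numMsg R₂ n) n => c.err erasureMAC) := fun n =>
      ⟨0, by rintro _ ⟨c, rfl⟩; exact hnonneg n c⟩
    -- The codes found so far depend on `ε`. A code within `1/(n+1)` of the least error at each
    -- blocklength works for every `ε` at once.
    have hbest : ∀ n : ℕ, ∃ c : AdvIdCode (Fin 2) (Fin 2) (Fin 3) (numMsg R₁ n) (numMsg R₂ n) n,
        c.err erasureMAC < (⨅ c : AdvIdCode (Fin 2) (Fin 2) (Fin 3) (numMsg R₁ n) (numMsg R₂ n) n,
          c.err erasureMAC) + 1 / ((n : ℝ) + 1) := by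
      intro n
      have : Nonempty (AdvIdCode (Fin 2) (Fin 2) (Fin 3) (numMsg R₁ n) (numMsg R₂ n) n) :=
        ⟨⟨fun _ _ => 0, fun _ _ => 0, fun _ => .blameOne⟩⟩
      exact exists_lt_of_ciInf_lt (lt_add_of_pos_right _ (by positivity))
    choose c hc using hbest
    refine ⟨c, ?_⟩
    rw [Metric.tendsto_atTop']
    intro ε hε
    have hε2 : 0 < ε / 2 := by positivity
    obtain ⟨N, hN⟩ := eventually_atTop.1 ((eventually_hasCode h1 h2 h3 h4 h5 hε2).and
      (tendsto_one_div_add_atTop_nhds_zero_nat.eventually_lt_const hε2))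
    refine ⟨N, fun n hn => ?_⟩
    obtain ⟨k1, k2⟩ := hN n (le_of_lt hn)
    obtain ⟨c', hc'⟩ := k1.exists_advIdCode (numMsg_pos h1.le n) (numMsg_pos h3.le n)
    rw [Real.dist_0_eq_abs, abs_of_nonneg (hnonneg n _)]
    have := ciInf_le (hbdd n) c'
    linarith [hc n]
  rintro ⟨R₁, R₂⟩ ⟨h1, h2, h3, h4, h5⟩
  simp only at h1 h2 h3 h4 h5
  -- Moving towards `(1/2, 1/2)` makes every constraint strict.
  have hlim : Tendsto (fun s : ℝ => ((1 - s) * R₁ + s * (1 / 2), (1 - s) * R₂ + s * (1 / 2)))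
      (𝓝[>] 0) (𝓝 (R₁, R₂)) := by
    refine Tendsto.mono_left ?_ nhdsWithin_le_nhds
    refine Continuous.tendsto' (by fun_prop) _ _ (by simp)
  refine mem_closure_of_tendsto hlim ?_
  filter_upwards [Ioo_mem_nhdsGT (zero_lt_one' ℝ)] with s ⟨hs0, hs1⟩
  have hs2 : 0 < 1 - s := by linarith
  have m1 := mul_nonneg hs2.le h1
  have m2 := mul_le_mul_of_nonneg_left h2 hs2.le
  have m3 := mul_nonneg hs2.le h3
  have m4 := mul_le_mul_of_nonneg_left h4 hs2.le
  have m5 := mul_le_mul_of_nonneg_left h5 hs2.le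
  exact hint _ _ (by linarith) (by linarith) (by linarith) (by linarith) (by linarith)

/-- An adversary identifying code gives a code for the non-adversarial channel. -/
lemma advIdCapacityRegion_subset {X Y Z : Type} [Fintype Z] (W : MAC X Y Z) :
    advIdCapacityRegion W ⊆ macCapacityRegion W := by
  refine closure_mono ?_
  rintro ⟨R₁, R₂⟩ ⟨h1, h2, c, hc⟩
  refine ⟨h1, h2, fun n => ⟨(c n).enc₁, (c n).enc₂, fun z => match (c n).dec z with
    | .messages a b => (a, b)
    | _ => (⟨0, numMsg_pos h1 n⟩, ⟨0, numMsg_pos h2 n⟩)⟩, ?_⟩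
  refine squeeze_zero (fun n => MACCode.err_nonneg _ W)
    (fun n => le_trans ?_ (le_max_left _ _)) hc
  refine mul_le_mul_of_nonneg_left ?_ (by positivity)
  refine Finset.sum_le_sum fun a _ => Finset.sum_le_sum fun b _ => Finset.sum_le_sum fun z _ => ?_
  -- Replacing blame by an arbitrary pair can only remove errors.
  refine Set.indicator_le_indicator_of_subset ?_
    (fun z => Finset.prod_nonneg fun _ _ => W.nonneg _ _ _) z
  intro w hw h
  refine hw ?_
  simp only [h]

end ByzMAC

theorem mainTheorem6 :
    ByzMAC.innerBound ByzMAC.erasureMAC = ByzMAC.macCapacityRegion ByzMAC.erasureMAC ∧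
    ByzMAC.advIdCapacityRegion ByzMAC.erasureMAC =
      ByzMAC.macCapacityRegion ByzMAC.erasureMAC ∧
    ByzMAC.macCapacityRegion ByzMAC.erasureMAC =
      {R : ℝ × ℝ | 0 ≤ R.1 ∧ R.1 ≤ 1 ∧ 0 ≤ R.2 ∧ R.2 ≤ 1 ∧ R.1 + R.2 ≤ 3 / 2} ∧
    Set.extremePoints ℝ (ByzMAC.macCapacityRegion ByzMAC.erasureMAC) =
      {(0, 0), (1, 0), (0, 1), (1 / 2, 1), (1, 1 / 2)} := by
  have hmac : ByzMAC.macCapacityRegion ByzMAC.erasureMAC = ByzMAC.pentagon :=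
    ByzMAC.macCapacityRegion_erasureMAC_subset.antisymm
      (ByzMAC.pentagon_subset_advIdCapacityRegion.trans (ByzMAC.advIdCapacityRegion_subset _))
  have hadv : ByzMAC.advIdCapacityRegion ByzMAC.erasureMAC = ByzMAC.pentagon :=
    ((ByzMAC.advIdCapacityRegion_subset _).trans hmac.subset).antisymm
      ByzMAC.pentagon_subset_advIdCapacityRegion
  refine ⟨ByzMAC.innerBound_erasureMAC.trans hmac.symm, hadv.trans hmac.symm, hmac, ?_⟩
  rw [hmac]
  exact ByzMAC.extremePoints_pentagon
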